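/- Let $n,k\ge 1$. An $(n,k)$ discrete-time Boolean finite dynamical system (DT-BFDS) is a family $\mathcal F=\{f_{i,j}\mid i\in[n],\,j\in[k]\}$ of functions $f_{i,j}\colon\{0,1\}^n\to\{0,1\}$; the elements of $\{0,1\}^n$ are its configurations. For a permutation $\pi$ of $[n]$ and a function selection $J=(j_1,\dots,j_n)\in[k]^n$ let $\mathcal F_\pi[J](c)$ be the configuration obtained from $c$ by updating the nodes one after the other in the order $\pi(1),\dots,\pi(n)$, where the update of node $i$ replaces the $i$-th entry of the current configuration $x$ by $f_{i,j_i}(x)$. The schedule of the system is either a nonempty list of permutations, which are then the permissible ones, or the arbitrary-permutation schedule, for which all permutations of $[n]$ are permissible. The system robustly takes $c$ to $d$ in $0$ time steps if $c=d$; for $t\ge1$ it robustly takes $c$ to $d$ in $t$ time steps if for every permissible $\pi$ there is a $J\in[k]^n$ such that the system robustly takes $\mathcal F_\pi[J](c)$ to $d$ in $t-1$ time steps. For fixed $t$, Robust $t$-Reachability is the following problem: given a system (with $n$ and $k$ in unary, each $f_{i,j}$ as a Boolean circuit, and the schedule, the entries of listed permutations being in binary) and two configurations $c,d$, decide whether the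 system robustly takes $c$ to $d$ in $t$ time steps. Theorem. Let $t\ge1$, $K$ and $q$ be fixed integers with $K,q\ge0$. Then Robust $t$-Reachability belongs to $\Pi^p_{2(t-1)}$ (which is $\mathrm P$ for $t=1$) when it is restricted to systems with at most $K$ choices per node ($k\le K$) in which each update function $f_{i,j}$ depends on at most $q$ of its $n$ arguments, or is the OR of some set of its arguments (of any size), or is the AND of some set of its arguments (of any size). That is, there is a language $L\in\Pi^p_{2(t-1)}$ such that for every input of the problem whose system satisfies these restrictions, the encoding of the input is in $L$ if and only if the answer to the question is yes. -/

import Mathlib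

namespace BFDS

/-! ### Polynomial time and the classes `Π^p_k` -/

/-- `R` is decided by a (multi-stack) Turing machine in time polynomial in the length of the
encoding of the argument. -/
def PolyTimeDecidable {α Γ : Type} (enc : α → List Γ) (R : α → Prop) : Prop :=
  ∃ V : α → Bool, (∀ a, V a = true ↔ R a) ∧
    Nonempty (Turing.TM2ComputableInPolyTime enc (fun b : Bool => [b]) V)

/-- The string `x # y₁ # ⋯ # yₘ` that stands for the tuple `(x, y₁, …, yₘ)`; the separator `#`
is `none`. -/
def encTuple {Γ : Type} (w : List Γ × List (List Bool)) : List (Option (Γ ⊕ Bool)) :=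
  w.1.map (fun a => some (Sum.inl a)) ++
    w.2.flatMap (fun y => none :: y.map (fun b => some (Sum.inr b)))

/-- `k` alternating quantifiers over binary strings of length at most `m`, applied to `R`; the
first quantifier is universal if the Boolean argument is `true` and existential if it is `false`.
The last argument collects the strings that have been chosen so far. -/
def AltQuant (m : ℕ) (R : List (List Bool) → Prop) : Bool → ℕ → List (List Bool) → Prop
  | _, 0, ys => R ys
  | true, k + 1, ys => ∀ y : List Bool, y.length ≤ m → AltQuant m R false k (ys ++ [y])
  | false, k + 1, ys => ∃ y : List Bool, y.length ≤ m ∧ AltQuant m R true k (ys ++ [y])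

/-- `L ∈ Π^p_k`: for some polynomial `p` and some polynomial-time decidable relation `R`,
`x ∈ L ↔ ∀ y₁ ∃ y₂ ∀ y₃ ⋯ Q y_k, R (x, y₁, …, y_k)`, where all `|y_i| ≤ p |x|`.
For `k = 0` there are no quantifiers, and the class is `P`. -/
def InPi {Γ : Type} (k : ℕ) (L : Language Γ) : Prop :=
  ∃ (p : Polynomial ℕ) (R : List Γ × List (List Bool) → Prop),
    PolyTimeDecidable encTuple R ∧
      ∀ x : List Γ, x ∈ L ↔ AltQuant (p.eval x.length) (fun ys => R (x, ys)) true k []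

/-- The decision problem "given an object `a` with `C a`, does `Q a` hold?", whose inputs are
written as strings by `enc`, is in `Π^p_k`. -/
def ProblemInPi {α Γ : Type} (k : ℕ) (enc : α → List Γ) (C Q : α → Prop) : Prop :=
  ∃ L : Language Γ, InPi k L ∧ ∀ a : α, C a → (enc a ∈ L ↔ Q a)

/-! ### Systems and robustness -/

/-- A configuration of `n` nodes. -/
abbrev Config (n : ℕ) : Type := Fin n → Bool

/-- An `n`-node, `k`-choice DT-BFDS: the family of update functions `f i j`. -/
abbrev DTBFDS (n k : ℕ) : Type := Fin n → Fin k → Config n → Bool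

/-- The configuration that `F` reaches from `c` in one sequential time step, when node `i` uses
its function number `J i` and the nodes update one after the other in the order
`π 0, π 1, …, π (n - 1)`. -/
def DTBFDS.run {n k : ℕ} (F : DTBFDS n k) (π : Equiv.Perm (Fin n)) (J : Fin n → Fin k)
    (c : Config n) : Config n :=
  (List.ofFn π).foldl (fun x i => Function.update x i (F i (J i) x)) c

/-- The updating schedules of a sequential system with a choice of sequences: a nonempty list of
permissible sequences, or all sequences. -/
inductive Schedule (n : ℕ) : Type
  | list (l : List (Equiv.Perm (Fin n))) (hl : l ≠ []) : Schedule n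
  | arbitrary : Schedule n

/-- The sequence `π` is permissible. -/
def Schedule.Permits {n : ℕ} : Schedule n → Equiv.Perm (Fin n) → Prop
  | .list l _, π => π ∈ l
  | .arbitrary, _ => True

/-- `F` with schedule `s` and individual function selection robustly takes `c` to `d` in the given
number of time steps. -/
def RobustlyTakes {n k : ℕ} (F : DTBFDS n k) (s : Schedule n) : ℕ → Config n → Config n → Prop
  | 0, c, d => c = d
  | t + 1, c, d => ∀ π : Equiv.Perm (Fin n), s.Permits π →
      ∃ (J : Fin n → Fin k) (c' : Config n), F.run π J c = c' ∧ RobustlyTakes F s t c' d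

/-! ### Types of update functions -/

/-- The value of `f` depends on its `i`-th argument. -/
def DependsOn {n : ℕ} (f : Config n → Bool) (i : Fin n) : Prop :=
  ∃ x : Config n, f (Function.update x i true) ≠ f (Function.update x i false)

/-- `f` depends on at most `q` arguments. -/
def HasFanIn {n : ℕ} (q : ℕ) (f : Config n → Bool) : Prop :=
  {i : Fin n | DependsOn f i}.ncard ≤ q

/-- `f` is the OR of some set of its arguments. -/
def IsOr {n : ℕ} (f : Config n → Bool) : Prop :=
  ∃ S : Finset (Fin n), ∀ x, f x = true ↔ ∃ i ∈ S, x i = true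

/-- `f` is the AND of some set of its arguments. -/
def IsAnd {n : ℕ} (f : Config n → Bool) : Prop :=
  ∃ S : Finset (Fin n), ∀ x, f x = true ↔ ∀ i ∈ S, x i = true

/-! ### Boolean circuits -/

/-- A gate of a circuit with `n` inputs; a natural number refers to the gate at that position. -/
inductive Gate (n : ℕ) : Type
  | input (i : Fin n) : Gate n
  | not (a : ℕ) : Gate n
  | and (l : List ℕ) : Gate n
  | or (l : List ℕ) : Gate n

/-- The positions of the gates that feed a gate. -/
def Gate.preds {n : ℕ} : Gate n → List ℕ
  | .input _ => []
  | .not a => [a]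
  | .and l => l
  | .or l => l

/-- A Boolean circuit with `n` inputs, as a topologically ordered nonempty list of gates; the last
gate is the output. -/
structure Circuit (n : ℕ) : Type where
  gates : List (Gate n)
  ne : gates ≠ []
  wf : ∀ (p : ℕ) (hp : p < gates.length), ∀ a ∈ (gates[p]).preds, a < p

/-- The value of a gate, given the input `x` and the list `v` of the values of the gates before
it. -/
def Gate.val {n : ℕ} (x : Config n) (v : List Bool) : Gate n → Bool
  | .input i => x i
  | .not a => !(v.getD a false)
  | .and l => l.all (fun a => v.getD a false)
  | .or l => l.any (fun a => v.getD a false)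

/-- The function that a circuit computes. -/
def Circuit.eval {n : ℕ} (C : Circuit n) (x : Config n) : Bool :=
  (C.gates.foldl (fun v g => v ++ [g.val x v]) []).getLastD false

/-! ### Instances and their encoding -/

/-- An input of the problem: an `(n, k)` system given by circuits, its schedule, and two
configurations. -/
structure Instance : Type where
  n : ℕ
  k : ℕ
  n_pos : 1 ≤ n
  k_pos : 1 ≤ k
  circ : Fin n → Fin k → Circuit n
  sched : Schedule n
  c : Config n
  d : Config n

/-- The system of an instance. -/
def Instance.system (I : Instance) : DTBFDS I.n I.k := fun i j => (I.circ i j).eval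

/-- The question of Robust `t`-Reachability. -/
def Instance.Robust (t : ℕ) (I : Instance) : Prop :=
  RobustlyTakes I.system I.sched t I.c I.d

/-- The system has at most `K` choices per node, and each update function has fan-in at most `q`,
or is an OR, or is an AND. -/
def Instance.Simple (K q : ℕ) (I : Instance) : Prop :=
  I.k ≤ K ∧ ∀ i j, HasFanIn q (I.system i j) ∨ IsOr (I.system i j) ∨ IsAnd (I.system i j)

/-- The alphabet in which instances are written. -/
inductive Letter : Type
  | bit (b : Bool) : Letter
  | comma : Letter
  | semicolon : Letter
  | close : Letter
  | inp : Letter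
  | not : Letter
  | and : Letter
  | or : Letter
  | all : Letter

/-- A number in unary. -/
def encUnary (m : ℕ) : List Letter := List.replicate m (Letter.bit true) ++ [Letter.comma]

/-- A number in binary, lowest bit first. -/
def encNat (m : ℕ) : List Letter := m.bits.map Letter.bit ++ [Letter.comma]

/-- The encoding of a gate. -/
def Gate.enc {n : ℕ} : Gate n → List Letter
  | .input i => [Letter.inp] ++ encNat i ++ [Letter.semicolon]
  | .not a => [Letter.not] ++ encNat a ++ [Letter.semicolon]
  | .and l => [Letter.and] ++ l.flatMap encNat ++ [Letter.semicolon]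
  | .or l => [Letter.or] ++ l.flatMap encNat ++ [Letter.semicolon]

/-- The encoding of a circuit. -/
def Circuit.enc {n : ℕ} (C : Circuit n) : List Letter :=
  C.gates.flatMap Gate.enc ++ [Letter.close]

/-- The encoding of a permutation, as the sequence of its `n` values in binary. -/
def encPerm {n : ℕ} (π : Equiv.Perm (Fin n)) : List Letter :=
  (List.ofFn π).flatMap (fun i => encNat i) ++ [Letter.semicolon]

/-- The encoding of a schedule. -/
def Schedule.enc {n : ℕ} : Schedule n → List Letter
  | .list l _ => l.flatMap encPerm ++ [Letter.close]
  | .arbitrary => [Letter.all, Letter.close]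

/-- The encoding of a configuration. -/
def encConfig {n : ℕ} (c : Config n) : List Letter :=
  (List.ofFn c).map Letter.bit ++ [Letter.semicolon]

/-- The encoding of an instance: `n` and `k` in unary, the circuits for all `f i j`, the schedule,
and the two configurations. -/
def Instance.enc (I : Instance) : List Letter :=
  encUnary I.n ++ encUnary I.k ++
    (List.finRange I.n).flatMap (fun i => (List.finRange I.k).flatMap (fun j => (I.circ i j).enc)) ++
    I.sched.enc ++ encConfig I.c ++ encConfig I.d

end BFDS

/-! Within one time step every node is updated exactly once, so the value a node receives is final
for that step. For a given order and a given target configuration, the choices of the nodes are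
therefore independent: when node `i` is updated, the nodes before it already have their target
values and the later ones still have their old values, and it only matters whether some `f i j`
yields the target value there (`exists_foldl_iff`, `run_iff_chain`). This is a polynomial-time test,
so a time step amounts to "for every permissible order there is a next configuration that passes the
test". The first `t - 1` steps give `2 * (t - 1)` alternating quantifiers, and membership follows
once the last step, whose target `d` is known, is decided in polynomial time without quantifiers.

For a list of orders the test is made for each of them. For the arbitrary schedule, the nodes
updated before `i` can form any set of other nodes. So the last step succeeds iff for every node `i`
and every `x` in the box of configurations with `x i = c i` and all entries from `c` or `d`, some `f
i j` has the value `d i` at `x` (`forall_chain_iff`). The box may be exponentially large, but few of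
its points matter. Let `e` be its least point if `d i` is true and its greatest point otherwise.
Given `x`, copy into `e` the entries of `x` on which the functions of small fan-in at node `i`
depend, at most `K * q` in number. At the resulting `y` these functions have the same values as at
`x`, while ORs and ANDs are monotone, and `y` lies on the side of `x` from which the value `d i`
carries over to `x`. So a suitable `f i j` at `y` is also suitable at `x`, and it is enough to
inspect the points obtained from `e` by `K * q` changes, polynomially many for fixed `K` and `q`
(`always_extreme_iff`).

The polynomial-time claim is proved down to Turing machines. Structured stack programs are compiled
to machines (`Prog.Run.simulate`). A class `PF` of functions on tree-coded data is shown to be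
closed under composition, pairing, case distinction and folds with polynomially bounded intermediate
values. The decoder and the tests are assembled from these. Whether an input satisfies the
restrictions is never tested, since membership in the language is only prescribed for inputs that
do. -/

namespace BFDS

/-! ### Structured programs over stacks -/

section Prog

/-- Structured programs that work on finitely many stacks. -/
inductive Prog {K : Type} (Γ : K → Type) : Type
  | skip : Prog Γ
  | push (k : K) (a : Γ k) : Prog Γ
  | pop (k : K) : Prog Γ
  | seq (p q : Prog Γ) : Prog Γ
  | case (k : K) (f : Option (Γ k) → Prog Γ) : Prog Γ
  | loop (k : K) (test : Option (Γ k) → Bool) (p : Prog Γ) : Prog Γ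

variable {K : Type} {Γ : K → Type}

/-- The program labels that a structured program is compiled to. -/
def Prog.Lab : Prog Γ → Type
  | .skip => Unit
  | .push _ _ => Unit
  | .pop _ => Unit
  | .seq p q => p.Lab ⊕ q.Lab
  | .case _ f => Option (Σ o, (f o).Lab)
  | .loop _ _ p => Option p.Lab

theorem Prog.finite_lab [∀ k, Finite (Γ k)] (p : Prog Γ) : Finite p.Lab := by
  induction p with
  | skip => exact inferInstanceAs (Finite Unit)
  | push => exact inferInstanceAs (Finite Unit)
  | pop => exact inferInstanceAs (Finite Unit)
  | seq p q hp hq => exact inferInstanceAs (Finite (p.Lab ⊕ q.Lab))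
  | case k f h => exact inferInstanceAs (Finite (Option (Σ o, (f o).Lab)))
  | loop k t p h => exact inferInstanceAs (Finite (Option p.Lab))

/-- The label at which a program starts. -/
def Prog.entry : (p : Prog Γ) → p.Lab
  | .skip => ()
  | .push _ _ => ()
  | .pop _ => ()
  | .seq p _ => Sum.inl p.entry
  | .case _ f => (none : Option (Σ o, (f o).Lab))
  | .loop _ _ p => (none : Option p.Lab)

variable [DecidableEq K]

/-- `p.Run s n s'`: started with stacks `s`, the program `p` stops within `n` steps with
stacks `s'`. -/
inductive Prog.Run : Prog Γ → (∀ k, List (Γ k)) → ℕ → (∀ k, List (Γ k)) → Prop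
  | skip {s n} (h : 1 ≤ n) : Run .skip s n s
  | push {s n k a} (h : 1 ≤ n) : Run (.push k a) s n (Function.update s k (a :: s k))
  | pop {s n k} (h : 1 ≤ n) : Run (.pop k) s n (Function.update s k (s k).tail)
  | seq {p q s₀ s₁ s₂ n₁ n₂ n} (hp : Run p s₀ n₁ s₁) (hq : Run q s₁ n₂ s₂) (h : n₁ + n₂ ≤ n) :
      Run (.seq p q) s₀ n s₂
  | case {k f s s' n m} (hf : Run (f (s k).head?) s n s') (h : n + 1 ≤ m) : Run (.case k f) s m s'
  | loop_done {k t p s n} (ht : t (s k).head? = false) (h : 1 ≤ n) : Run (.loop k t p) s n s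
  | loop_step {k t p s₀ s₁ s₂ n₁ n₂ n} (ht : t (s₀ k).head? = true) (hp : Run p s₀ n₁ s₁)
      (hl : Run (.loop k t p) s₁ n₂ s₂) (h : n₁ + n₂ + 1 ≤ n) : Run (.loop k t p) s₀ n s₂

/-- A program pushes at most one symbol per step. -/
theorem Prog.Run.length_le {p : Prog Γ} {s s' : ∀ k, List (Γ k)} {n : ℕ} (h : p.Run s n s')
    (k : K) : (s' k).length ≤ (s k).length + n := by
  induction h with
  | skip h => omega
  | @push s n j a h =>
    rcases eq_or_ne k j with rfl | hk
    · simpa using h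
    · simp [Function.update_of_ne hk]
  | @pop s n j h =>
    rcases eq_or_ne k j with rfl | hk
    · simp; omega
    · simp [Function.update_of_ne hk]
  | seq hp hq h ihp ihq => omega
  | case hf h ih => omega
  | loop_done ht h => omega
  | loop_step ht hp hl h ihp ihl => omega

open Turing.TM2.Stmt in
/-- The statement at each label of a program that is placed into a machine by `emb` and that
continues at the label `exit`. -/
def Prog.code {Λ : Type} : (p : Prog Γ) → (p.Lab → Λ) → Λ → p.Lab →
    Turing.TM2.Stmt Γ Λ (∀ k, Option (Γ k))
  | .skip, _, exit, _ => goto fun _ => exit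
  | .push k a, _, exit, _ => Turing.TM2.Stmt.push k (fun _ => a) (goto fun _ => exit)
  | .pop k, _, exit, _ => Turing.TM2.Stmt.pop k (fun v _ => v) (goto fun _ => exit)
  | .seq p q, emb, exit, l =>
      match l with
      | Sum.inl l => p.code (fun l => emb (Sum.inl l)) (emb (Sum.inr q.entry)) l
      | Sum.inr l => q.code (fun l => emb (Sum.inr l)) exit l
  | .case k f, emb, exit, l =>
      match (l : Option (Σ o, (f o).Lab)) with
      | none => peek k (fun v o => Function.update v k o)
          (goto fun v => emb (some ⟨v k, (f (v k)).entry⟩ : Option (Σ o, (f o).Lab)))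
      | some ⟨o, l⟩ => (f o).code (fun l => emb (some ⟨o, l⟩ : Option (Σ o, (f o).Lab))) exit l
  | .loop k t p, emb, exit, l =>
      match (l : Option p.Lab) with
      | none => peek k (fun v o => Function.update v k o)
          (goto fun v => if t (v k) then emb (some p.entry : Option p.Lab) else exit)
      | some l => p.code (fun l => emb (some l : Option p.Lab)) (emb (none : Option p.Lab)) l

/-- Induction on the run. The machine `M` is arbitrary apart from its statements at the labels `emb
l`, so a subprogram is handled by composing `emb` with the inclusion of its labels. The internal
state only buffers the symbol peeked last on each stack, hence its initial value `v` is irrelevant.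
-/
theorem Prog.Run.simulate {Λ : Type} {M : Λ → Turing.TM2.Stmt Γ Λ (∀ k, Option (Γ k))}
    {p : Prog Γ} {s s' : ∀ k, List (Γ k)} {n : ℕ} (h : p.Run s n s') :
    ∀ (emb : p.Lab → Λ) (exit : Λ), (∀ l, M (emb l) = p.code emb exit l) →
    ∀ v, ∃ m ≤ n, ∃ v', (flip bind (Turing.TM2.step M))^[m] (some ⟨some (emb p.entry), v, s⟩) =
      some ⟨some exit, v', s'⟩ := by
  induction h with
  | skip h =>
    intro emb exit hM v
    exact ⟨1, h, v, by simp [flip, hM, Prog.code]⟩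
  | push h =>
    intro emb exit hM v
    exact ⟨1, h, v, by simp [flip, hM, Prog.code]⟩
  | pop h =>
    intro emb exit hM v
    exact ⟨1, h, v, by simp [flip, hM, Prog.code]⟩
  | @seq p q s₀ s₁ s₂ n₁ n₂ n hp hq h ihp ihq =>
    intro emb exit hM v
    obtain ⟨m₁, h₁, v₁, e₁⟩ := ihp (fun l => emb (Sum.inl l)) (emb (Sum.inr q.entry))
      (fun l => hM (Sum.inl l)) v
    obtain ⟨m₂, h₂, v₂, e₂⟩ := ihq (fun l => emb (Sum.inr l)) exit (fun l => hM (Sum.inr l)) v₁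
    refine ⟨m₂ + m₁, by omega, v₂, ?_⟩
    rw [Function.iterate_add_apply]
    exact (congrArg _ e₁).trans e₂
  | @case k f s s' n m hf h ih =>
    intro emb exit hM v
    obtain ⟨m₁, h₁, v₁, e₁⟩ := ih
      (fun l => emb (some ⟨_, l⟩ : Option (Σ o, (f o).Lab))) exit (fun l => hM (some ⟨_, l⟩))
      (Function.update v k (s k).head?)
    refine ⟨m₁ + 1, by omega, v₁, ?_⟩
    rw [Function.iterate_add_apply, ← e₁]
    congr 1
    have := hM (none : Option (Σ o, (f o).Lab))
    simp only [Prog.entry, Function.iterate_one, flip, Option.bind_eq_bind, Option.bind_some,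
      Turing.TM2.step]
    rw [this]
    have hu : ∀ o, o = (s k).head? → (some ⟨o, (f o).entry⟩ : Option (Σ o, (f o).Lab)) =
        some ⟨(s k).head?, (f (s k).head?).entry⟩ := by
      rintro _ rfl
      rfl
    simp only [Prog.code, Turing.TM2.stepAux]
    rw [hu _ (Function.update_self k _ v)]
  | @loop_done k t p s n ht h =>
    intro emb exit hM v
    refine ⟨1, h, Function.update v k (s k).head?, ?_⟩
    have := hM (none : Option p.Lab)
    simp only [Prog.entry, Function.iterate_one, flip, Option.bind_eq_bind, Option.bind_some,
      Turing.TM2.step]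
    rw [this]
    simp [Prog.code, ht]
  | @loop_step k t p s₀ s₁ s₂ n₁ n₂ n ht hp hl h ihp ihl =>
    intro emb exit hM v
    obtain ⟨m₁, h₁, v₁, e₁⟩ := ihp (fun l => emb (some l : Option p.Lab))
      (emb (none : Option p.Lab)) (fun l => hM (some l)) (Function.update v k (s₀ k).head?)
    obtain ⟨m₂, h₂, v₂, e₂⟩ := ihl emb exit hM v₁
    refine ⟨m₂ + (m₁ + 1), by omega, v₂, ?_⟩
    rw [Function.iterate_add_apply, ← e₂]
    congr 1
    rw [Function.iterate_add_apply]
    refine Eq.trans ?_ e₁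
    congr 1
    have := hM (none : Option p.Lab)
    simp only [Prog.entry, Function.iterate_one, flip, Option.bind_eq_bind, Option.bind_some,
      Turing.TM2.step]
    rw [this]
    simp [Prog.code, ht]

/-- The machine that runs a program and then halts. -/
noncomputable def Prog.machine [Fintype K] [∀ k, Fintype (Γ k)] (p : Prog Γ) (k₀ k₁ : K) :
    Turing.FinTM2 :=
  haveI := p.finite_lab
  { K := K
    k₀ := k₀
    k₁ := k₁
    Γ := Γ
    Λ := Option p.Lab
    ΛFin := Fintype.ofFinite _
    main := some p.entry
    σ := ∀ k, Option (Γ k)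
    initialState := fun _ => none
    m := fun l =>
      match l with
      | none => .load (fun _ _ => none) .halt
      | some l => p.code some none l }

/-- The left side is the form in which `Turing.initList` and `Turing.haltList` describe the stacks.
-/
theorem dite_eq_update (k₀ k : K) (s : List (Γ k₀)) :
    (if h : k = k₀ then (by rw [h]; exact s) else [] : List (Γ k)) =
      Function.update (fun _ => []) k₀ s k := by
  by_cases h : k = k₀
  · subst h
    simp
  · simp [h]

theorem polyTimeDecidable_of_run [Fintype K] [∀ k, Fintype (Γ k)] {α : Type} {k₀ k₁ : K}
    (e : Γ k₁ ≃ Bool) (enc : α → List (Γ k₀)) (V : α → Bool) (p : Prog Γ) (P : Polynomial ℕ)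
    (h : ∀ a, p.Run (Function.update (fun _ => []) k₀ (enc a)) (P.eval (enc a).length)
      (Function.update (fun _ => []) k₁ [e.symm (V a)])) :
    PolyTimeDecidable enc (fun a => V a = true) := by
  refine ⟨V, fun _ => Iff.rfl, ⟨⟨⟨p.machine k₀ k₁, Equiv.refl _, e⟩, P + 1, fun a => ?_⟩⟩⟩
  have key : ∃ m ≤ P.eval (enc a).length + 1,
      (flip bind (p.machine k₀ k₁).step)^[m]
        (some (Turing.initList (p.machine k₀ k₁) ((enc a).map (Equiv.refl _).invFun))) =
      some (Turing.haltList (p.machine k₀ k₁) [e.symm (V a)]) := by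
    obtain ⟨m, hm, v', hv⟩ := (h a).simulate (M := (p.machine k₀ k₁).m) some none
      (fun l => rfl) (fun _ => none)
    -- After the `m` simulated steps, one more step at the label `none` resets the internal state,
    -- as `Turing.haltList` demands, and halts.
    refine ⟨1 + m, by omega, ?_⟩
    rw [Function.iterate_add_apply]
    have hi : Turing.initList (p.machine k₀ k₁) ((enc a).map (Equiv.refl _).invFun) =
        ⟨some (some p.entry), fun _ => none, Function.update (fun _ => []) k₀ (enc a)⟩ := by
      unfold Turing.initList
      congr 1
      funext k
      exact (dite_eq_update k₀ k _).trans (by simp [Equiv.refl]; rfl)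
    rw [hi]
    refine (congrArg _ hv).trans ?_
    have hh : Turing.haltList (p.machine k₀ k₁) [e.symm (V a)] =
        ⟨none, fun _ => none, Function.update (fun _ => []) k₁ [e.symm (V a)]⟩ := by
      unfold Turing.haltList
      congr 1
      funext k
      exact dite_eq_update k₁ k _
    rw [hh]
    rfl
  exact
    { steps := key.choose
      steps_le_m := by simpa using key.choose_spec.1
      evals_in_steps := key.choose_spec.2 }

end Prog

/-! ### Binary trees on a stack -/

/-- The stacks of the machines below: input, output, a main stack and three auxiliary ones. -/
inductive Reg : Type
  | inp | out | main | aux₁ | aux₂ | count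
  deriving DecidableEq

instance : Fintype Reg :=
  ⟨{.inp, .out, .main, .aux₁, .aux₂, .count}, by intro r; cases r <;> simp⟩

/-- The symbols in which tuples of an instance and some binary strings are written. -/
abbrev Sym : Type := Option (Letter ⊕ Bool)

/-- The alphabets of the stacks. -/
abbrev Alph : Reg → Type
  | .inp => Sym
  | .out => Bool
  | .main => Bool
  | .aux₁ => Option Bool
  | .aux₂ => Option Bool
  | .count => Bool

/-- The contents of all stacks. -/
def store (i : List Sym) (o m : List Bool) (a b : List (Option Bool)) (c : List Bool) :
    ∀ r, List (Alph r)
  | .inp => i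
  | .out => o
  | .main => m
  | .aux₁ => a
  | .aux₂ => b
  | .count => c

section store

variable (i i' : List Sym) (o o' m m' : List Bool) (a a' b b' : List (Option Bool))
  (c c' : List Bool)

@[simp] theorem update_inp :
    Function.update (store i o m a b c) .inp i' = store i' o m a b c := by
  funext r; cases r <;> rfl

@[simp] theorem update_out :
    Function.update (store i o m a b c) .out o' = store i o' m a b c := by
  funext r; cases r <;> rfl

@[simp] theorem update_main :
    Function.update (store i o m a b c) .main m' = store i o m' a b c := by
  funext r; cases r <;> rfl

@[simp] theorem update_aux₁ :
    Function.update (store i o m a b c) .aux₁ a' = store i o m a' b c := by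
  funext r; cases r <;> rfl

@[simp] theorem update_aux₂ :
    Function.update (store i o m a b c) .aux₂ b' = store i o m a b' c := by
  funext r; cases r <;> rfl

@[simp] theorem update_count :
    Function.update (store i o m a b c) .count c' = store i o m a b c' := by
  funext r; cases r <;> rfl

theorem store_nil : (fun _ => []) = store [] [] [] [] [] [] := by
  funext r; cases r <;> rfl

end store

/-- Two programs in a row, in the notation of a sequence. -/
infixr:60 " ;; " => Prog.seq

theorem Prog.Run.push' {s s' : ∀ r, List (Alph r)} {r : Reg} {x : Alph r}
    (h : Function.update s r (x :: s r) = s') : (Prog.push r x).Run s 1 s' :=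
  h ▸ .push le_rfl

theorem Prog.Run.pop' {s s' : ∀ r, List (Alph r)} {r : Reg}
    (h : Function.update s r (s r).tail = s') : (Prog.pop (Γ := Alph) r).Run s 1 s' :=
  h ▸ .pop le_rfl

/-- Binary trees. -/
inductive Data : Type
  | leaf : Data
  | node (t u : Data) : Data

/-- The prefix code of a tree. -/
def Data.code : Data → List Bool
  | .leaf => [false]
  | .node t u => true :: (t.code ++ u.code)

/-- The stack that results from `a` by pushing the symbols of `x` one after the other, if `p`. -/
def pushIf (p : Bool) (x : List Bool) (a : List (Option Bool)) : List (Option Bool) :=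
  if p then x.reverse.map some ++ a else a

theorem pushIf_append (p : Bool) (x y : List Bool) (a : List (Option Bool)) :
    pushIf p (x ++ y) a = pushIf p y (pushIf p x a) := by
  cases p <;> simp [pushIf]

/-- Push a symbol on those of the two auxiliary stacks that are selected. -/
def saveSymbol (p₁ p₂ : Bool) (x : Bool) : Prog Alph :=
  (if p₁ then .push .aux₁ (some x) else .skip) ;; (if p₂ then .push .aux₂ (some x) else .skip)

theorem run_saveSymbol (p₁ p₂ x : Bool) (i o m a b c) :
    (saveSymbol p₁ p₂ x).Run (store i o m a b c) 2
      (store i o m (pushIf p₁ [x] a) (pushIf p₂ [x] b) c) := by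
  refine .seq (s₁ := store i o m (pushIf p₁ [x] a) b c) (n₁ := 1) (n₂ := 1) ?_ ?_ le_rfl
  · cases p₁
    · exact .skip le_rfl
    · exact .push' (by simp; rfl)
  · cases p₂
    · exact .skip le_rfl
    · exact .push' (by simp; rfl)

/-- The body of the loop that removes a tree from the main stack. -/
def scanBody (p₁ p₂ : Bool) : Prog Alph :=
  .pop .count ;; .case .main fun o =>
    match o with
    | some true => .pop .main ;; saveSymbol p₁ p₂ true ;; .push .count true ;; .push .count true
    | some false => .pop .main ;; saveSymbol p₁ p₂ false
    | none => .skip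

/-- The loop that removes as many trees from the main stack as the counter says. -/
def scanLoop (p₁ p₂ : Bool) : Prog Alph :=
  .loop .count (fun o => o == some true) (scanBody p₁ p₂)

/-- Remove a tree from the main stack and push its symbols on some auxiliary stacks. -/
def scan (p₁ p₂ : Bool) : Prog Alph :=
  .push .count false ;; .push .count true ;; scanLoop p₁ p₂ ;; .pop .count

/-- Each `true` on the counter stands for a tree still to be removed; reading the symbol of an inner
node replaces one such tree by two. The statement is in continuation form, from a run after the
removal to a run before it, so that the induction hypotheses for the two subtrees can be chained. A
pass of the loop takes at most 8 steps and removes one symbol. -/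
theorem run_scanLoop (p₁ p₂ : Bool) (i o) (t : Data) : ∀ (m a b c n s'),
    (scanLoop p₁ p₂).Run
      (store i o m (pushIf p₁ t.code a) (pushIf p₂ t.code b) c) n s' →
    (scanLoop p₁ p₂).Run (store i o (t.code ++ m) a b (true :: c)) (n + 8 * t.code.length) s' := by
  induction t with
  | leaf =>
    intro m a b c n s' h
    refine .loop_step (n₁ := 5) rfl (.seq (n₁ := 1) (n₂ := 4) (.pop' rfl) ?_ le_rfl) h
      (by simp [Data.code]; omega)
    refine .case (n := 3) ?_ le_rfl
    refine .seq (n₁ := 1) (n₂ := 2) (.pop' rfl) ?_ le_rfl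
    simpa [Data.code, store] using run_saveSymbol p₁ p₂ false i o m a b c
  | node t u iht ihu =>
    intro m a b c n s' h
    have h' := iht (u.code ++ m) (pushIf p₁ [true] a) (pushIf p₂ [true] b) (true :: c) _ _
      (ihu m (pushIf p₁ t.code (pushIf p₁ [true] a)) (pushIf p₂ t.code (pushIf p₂ [true] b)) c n s'
        (by simpa only [← pushIf_append, List.append_assoc, Data.code,
          List.cons_append, List.nil_append] using h))
    refine .loop_step (n₁ := 7) rfl (.seq (n₁ := 1) (n₂ := 6) (.pop' rfl) ?_ le_rfl) h'
      (by simp [Data.code]; omega)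
    refine .case (n := 5) ?_ le_rfl
    refine .seq (n₁ := 1) (n₂ := 4) (.pop' rfl) ?_ le_rfl
    refine .seq (n₁ := 2) (n₂ := 2)
      (s₁ := store i o (t.code ++ (u.code ++ m)) (pushIf p₁ [true] a) (pushIf p₂ [true] b) c)
      ?_ ?_ le_rfl
    · simpa [Data.code, store] using
        run_saveSymbol p₁ p₂ true i o (t.code ++ (u.code ++ m)) a b c
    · exact .seq (.push' rfl) (.push' (by simp; rfl)) le_rfl

theorem run_scan (p₁ p₂ : Bool) (t : Data) (i o m a b c) :
    (scan p₁ p₂).Run (store i o (t.code ++ m) a b c) (8 * t.code.length + 4)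
      (store i o m (pushIf p₁ t.code a) (pushIf p₂ t.code b) c) := by
  refine .seq (n₁ := 1) (n₂ := 8 * t.code.length + 3) (.push' (update_count ..)) ?_ (by omega)
  -- The `false` pushed first is a sentinel that stops the loop above the old contents `c` of the
  -- counter.
  refine .seq (n₁ := 1) (n₂ := 8 * t.code.length + 2) (.push' (update_count ..)) ?_ (by omega)
  refine .seq (n₁ := 1 + 8 * t.code.length) (n₂ := 1)
    (run_scanLoop p₁ p₂ i o t _ _ _ _ _ _ (.loop_done rfl le_rfl)) ?_ (by omega)
  exact .pop' (update_count ..)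

/-- Move the symbols above the topmost marker of the first auxiliary stack to the main stack. -/
def unload₁ : Prog Alph :=
  .loop .aux₁ (fun o => o.join.isSome)
    (.case .aux₁ fun o =>
      match o with
      | some (some x) => .pop .aux₁ ;; .push .main x
      | _ => .skip) ;;
  .pop .aux₁

/-- Move the symbols above the topmost marker of the second auxiliary stack to the main stack. -/
def unload₂ : Prog Alph :=
  .loop .aux₂ (fun o => o.join.isSome)
    (.case .aux₂ fun o =>
      match o with
      | some (some x) => .pop .aux₂ ;; .push .main x
      | _ => .skip) ;;
  .pop .aux₂

theorem run_unload₁ (i o a b c) (x m : List Bool) :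
    unload₁.Run (store i o m (pushIf true x (none :: a)) b c) (4 * x.length + 2)
      (store i o (x ++ m) a b c) := by
  refine .seq (n₁ := 4 * x.length + 1) (n₂ := 1)
    (s₁ := store i o (x ++ m) (none :: a) b c) ?_ (.pop' (update_aux₁ ..)) le_rfl
  -- The top of the auxiliary stack is the last symbol of `x`; unloading reverses the order a second
  -- time and restores it.
  induction x using List.reverseRecOn generalizing m with
  | nil => exact .loop_done rfl le_rfl
  | append_singleton x y ih =>
    rw [pushIf_append]
    refine .loop_step (n₁ := 3) (n₂ := 4 * x.length + 1)
      (s₁ := store i o (y :: m) (pushIf true x (none :: a)) b c) rfl ?_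
      (by simpa using ih (y :: m)) (by simp; omega)
    exact .case (n := 2) (.seq (.pop' (update_aux₁ ..)) (.push' (update_main ..)) le_rfl) le_rfl

theorem run_unload₂ (i o a b c) (x m : List Bool) :
    unload₂.Run (store i o m a (pushIf true x (none :: b)) c) (4 * x.length + 2)
      (store i o (x ++ m) a b c) := by
  refine .seq (n₁ := 4 * x.length + 1) (n₂ := 1)
    (s₁ := store i o (x ++ m) a (none :: b) c) ?_ (.pop' (update_aux₂ ..)) le_rfl
  induction x using List.reverseRecOn generalizing m with
  | nil => exact .loop_done rfl le_rfl
  | append_singleton x y ih =>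
    rw [pushIf_append]
    refine .loop_step (n₁ := 3) (n₂ := 4 * x.length + 1)
      (s₁ := store i o (y :: m) a (pushIf true x (none :: b)) c) rfl ?_
      (by simpa using ih (y :: m)) (by simp; omega)
    exact .case (n := 2) (.seq (.pop' (update_aux₂ ..)) (.push' (update_main ..)) le_rfl) le_rfl

/-- All stacks but the main one are empty. -/
def onMain (m : List Bool) : ∀ r, List (Alph r) := store [] [] m [] [] []

/-- Remove the top tree. -/
def dropTree : Prog Alph := scan false false

theorem run_dropTree (t : Data) (m) :
    dropTree.Run (onMain (t.code ++ m)) (8 * t.code.length + 4) (onMain m) :=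
  run_scan false false t [] [] m [] [] []

/-- Duplicate the top tree. -/
def dupTree : Prog Alph :=
  .push .aux₁ none ;; .push .aux₂ none ;; scan true true ;; unload₁ ;; unload₂

theorem run_dupTree (t : Data) (m) :
    dupTree.Run (onMain (t.code ++ m)) (16 * t.code.length + 10)
      (onMain (t.code ++ (t.code ++ m))) := by
  refine .seq (n₁ := 1) (n₂ := 16 * t.code.length + 9) (.push' (update_aux₁ ..)) ?_ (by omega)
  refine .seq (n₁ := 1) (n₂ := 16 * t.code.length + 8) (.push' (update_aux₂ ..)) ?_ (by omega)
  exact .seq (run_scan true true t _ _ _ _ _ _)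
    (.seq (run_unload₁ _ _ _ _ _ _ _) (run_unload₂ _ _ _ _ _ _ _) le_rfl) (by omega)

/-- Exchange the two top trees. -/
def swapTrees : Prog Alph :=
  .push .aux₁ none ;; .push .aux₂ none ;; scan true false ;; scan false true ;; unload₁ ;; unload₂

theorem run_swapTrees (t u : Data) (m) :
    swapTrees.Run (onMain (t.code ++ (u.code ++ m))) (12 * t.code.length + 12 * u.code.length + 14)
      (onMain (u.code ++ (t.code ++ m))) := by
  refine .seq (n₁ := 1) (n₂ := 12 * t.code.length + 12 * u.code.length + 13)
    (.push' (update_aux₁ ..)) ?_ (by omega)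
  refine .seq (n₁ := 1) (n₂ := 12 * t.code.length + 12 * u.code.length + 12)
    (.push' (update_aux₂ ..)) ?_ (by omega)
  refine .seq (run_scan true false t _ _ _ _ _ _) (.seq (run_scan false true u _ _ _ _ _ _)
    (.seq (run_unload₁ _ _ _ _ _ _ _) (run_unload₂ _ _ _ _ _ _ _) le_rfl) le_rfl) (by omega)

/-- Push a word on the main stack, its last symbol first. -/
def pushWord : List Bool → Prog Alph
  | [] => .skip
  | x :: w => pushWord w ;; .push .main x

theorem run_pushWord (i o a b c) (w m : List Bool) :
    (pushWord w).Run (store i o m a b c) (w.length + 1) (store i o (w ++ m) a b c) := by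
  induction w with
  | nil => exact .skip le_rfl
  | cons x w ih => exact .seq ih (.push' (update_main ..)) le_rfl

/-! ### Polynomial-time functions between encoded types -/

/-- A type whose elements are represented by binary trees. -/
class Enc (α : Type) where
  toData : α → Data

/-- The code word of an element. -/
def word {α : Type} [Enc α] (a : α) : List Bool := (Enc.toData a).code

/-- The length of the code word of an element. -/
def sz {α : Type} [Enc α] (a : α) : ℕ := (word a).length

instance : Enc Unit := ⟨fun _ => .leaf⟩

instance : Enc Bool := ⟨fun b => if b then .node .leaf .leaf else .leaf⟩

instance {α β : Type} [Enc α] [Enc β] : Enc (α × β) :=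
  ⟨fun x => .node (Enc.toData x.1) (Enc.toData x.2)⟩

/-- The tree that represents a list. -/
def listData {α : Type} [Enc α] : List α → Data
  | [] => .leaf
  | a :: l => .node (Enc.toData a) (listData l)

instance {α : Type} [Enc α] : Enc (List α) := ⟨listData⟩

/-- Numbers are unary here, so polynomially bounded size means polynomially bounded value. The
binary numbers of the input are therefore cut off when they are read. -/
instance : Enc ℕ := ⟨fun n => listData (List.replicate n ())⟩

/-! ### Sizes of code words -/

section size

variable {α β : Type} [Enc α] [Enc β]

theorem word_pair (a : α) (b : β) : word (a, b) = true :: (word a ++ word b) := rfl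

/-- A nonempty list has the same code word as the pair of its head and tail, so passing between the
two costs nothing. -/
theorem word_cons (a : α) (l : List α) : word (a :: l) = true :: (word a ++ word l) := rfl

@[simp] theorem sz_pair (a : α) (b : β) : sz (a, b) = 1 + sz a + sz b := by
  simp [sz, word_pair]; omega

@[simp] theorem sz_nil : sz ([] : List α) = 1 := rfl

@[simp] theorem sz_cons (a : α) (l : List α) : sz (a :: l) = 1 + sz a + sz l := by
  simp [sz, word_cons]; omega

@[simp] theorem sz_unit (a : Unit) : sz a = 1 := rfl

@[simp] theorem sz_nat (n : ℕ) : sz n = 2 * n + 1 := by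
  have : sz n = sz (List.replicate n ()) := rfl
  rw [this]
  induction n with
  | zero => rfl
  | succ n ih => rw [List.replicate_succ, sz_cons, ih rfl, sz_unit]; omega

theorem sz_bool_le (b : Bool) : sz b ≤ 3 := by cases b <;> decide

theorem sz_pos (a : α) : 1 ≤ sz a := by
  unfold sz word
  cases Enc.toData a <;> simp [Data.code]

theorem length_le_sz (l : List α) : l.length ≤ sz l := by
  induction l with
  | nil => simp
  | cons a l ih => simp; omega

theorem sz_append (l l' : List α) : sz (l ++ l') + 1 = sz l + sz l' := by
  induction l with
  | nil => simp; omega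
  | cons a l ih => simp; omega

theorem sz_le_of_mem {a : α} {l : List α} (h : a ∈ l) : sz a ≤ sz l := by
  induction l with
  | nil => simp at h
  | cons b l ih =>
    rcases List.mem_cons.1 h with rfl | h
    · simp; omega
    · have := ih h; simp; omega

theorem sz_le_of_suffix {l l' : List α} (h : l <:+ l') : sz l ≤ sz l' := by
  obtain ⟨m, rfl⟩ := h
  have := sz_append m l
  have := sz_pos m
  omega

theorem sz_list_le {l : List α} {B : ℕ} (h : ∀ a ∈ l, sz a ≤ B) :
    sz l ≤ l.length * (B + 1) + 1 := by
  induction l with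
  | nil => simp
  | cons a l ih =>
    have h₁ := h a (by simp)
    have h₂ := ih fun b hb => h b (by simp [hb])
    simp only [sz_cons, List.length_cons]
    nlinarith

end size

/-- The coefficients are natural numbers, so every term is monotone. -/
theorem eval_mono (P : Polynomial ℕ) {m n : ℕ} (h : m ≤ n) : P.eval m ≤ P.eval n := by
  rw [Polynomial.eval_eq_sum, Polynomial.eval_eq_sum]
  exact Finset.sum_le_sum fun i _ => Nat.mul_le_mul_left _ (Nat.pow_le_pow_left h i)

/-! ### Closure properties of polynomial-time functions -/

section closure

variable {α β γ δ σ : Type} [Enc α] [Enc β] [Enc γ] [Enc δ] [Enc σ]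

/-- The function `f` is computed in polynomial time by a program that replaces the code word of
the argument on the top of the main stack by that of the value. -/
@[fun_prop]
def PF (f : α → β) : Prop :=
  ∃ (p : Prog Alph) (P : Polynomial ℕ), ∀ a m,
    p.Run (onMain (word a ++ m)) (P.eval (sz a)) (onMain (word (f a) ++ m))

/-- The values of `f` have polynomially bounded size. -/
def SizeBdd (f : α → β) : Prop := ∃ P : Polynomial ℕ, ∀ a, sz (f a) ≤ P.eval (sz a)

/-- At most one symbol is pushed per step, so the time bound also limits the growth. This is what
makes time bounds compose in `PF.comp`. -/
theorem PF.sizeBdd {f : α → β} (h : PF f) : SizeBdd f := by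
  obtain ⟨p, P, hp⟩ := h
  refine ⟨Polynomial.X + P, fun a => ?_⟩
  have := (hp a []).length_le .main
  simpa [onMain, store, sz] using this

theorem PF.of_eq {f g : α → β} (h : PF f) (e : ∀ a, f a = g a) : PF g :=
  (funext e : f = g) ▸ h

@[fun_prop]
theorem PF.id : PF (fun a : α => a) :=
  ⟨.skip, 1, fun a m => .skip (by simp)⟩

@[fun_prop]
theorem PF.comp {g : β → γ} {f : α → β} (hg : PF g) (hf : PF f) : PF (fun a => g (f a)) := by
  obtain ⟨R, hR⟩ := hf.sizeBdd
  obtain ⟨p, P, hp⟩ := hf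
  obtain ⟨q, Q, hq⟩ := hg
  refine ⟨p ;; q, P + Q.comp R, fun a m => .seq (hp a m) (hq (f a) m) ?_⟩
  simpa using eval_mono Q (hR a)

@[fun_prop]
theorem PF.pair {f : α → β} {g : α → γ} (hf : PF f) (hg : PF g) : PF (fun a => (f a, g a)) := by
  obtain ⟨R, hR⟩ := hg.sizeBdd
  obtain ⟨p, P, hp⟩ := hf
  obtain ⟨q, Q, hq⟩ := hg
  refine ⟨dupTree ;; q ;; swapTrees ;; p ;; .push .main true,
    (16 * Polynomial.X + 10) + Q + (12 * R + 12 * Polynomial.X + 14) + P + 1, fun a m => ?_⟩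
  refine .seq (run_dupTree _ m) (.seq (hq a (word a ++ m)) (.seq (run_swapTrees _ _ m)
    (.seq (hp a _) (.push' (by simp [onMain, word_pair, store]; rfl)) le_rfl) le_rfl) le_rfl) ?_
  have := hR a
  simp only [sz, word] at this
  simp [sz, word]
  omega

theorem PF.fst' : PF (Prod.fst : α × β → α) := by
  refine ⟨.pop .main ;; swapTrees ;; dropTree, 24 * Polynomial.X + 30, fun ⟨a, b⟩ m => ?_⟩
  refine .seq (s₁ := onMain (word a ++ (word b ++ m)))
    (.pop' (by simp [onMain, word_pair, store]))
    (.seq (run_swapTrees _ _ m) (run_dropTree _ _) le_rfl) ?_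
  have := sz_pair a b
  simp only [sz, word] at this
  simp [sz, word]
  omega

theorem PF.snd' : PF (Prod.snd : α × β → β) := by
  refine ⟨.pop .main ;; dropTree, 8 * Polynomial.X + 5, fun ⟨a, b⟩ m => ?_⟩
  refine .seq (s₁ := onMain (word a ++ (word b ++ m)))
    (.pop' (by simp [onMain, word_pair, store])) (run_dropTree _ _) ?_
  have := sz_pair a b
  simp only [sz, word] at this
  simp [sz, word]
  omega

@[fun_prop]
theorem PF.fst {f : α → β × γ} (hf : PF f) : PF (fun a => (f a).1) := PF.fst'.comp hf

@[fun_prop]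
theorem PF.snd {f : α → β × γ} (hf : PF f) : PF (fun a => (f a).2) := PF.snd'.comp hf

@[fun_prop]
theorem PF.const (b : β) : PF (fun _ : α => b) := by
  refine ⟨dropTree ;; pushWord (word b), 8 * Polynomial.X + 5 + Polynomial.C (sz b), fun a m =>
    .seq (run_dropTree _ m) (run_pushWord [] [] [] [] [] (word b) m) ?_⟩
  simp [sz, word]
  omega

/-- Functions that do not change the code words are computable. -/
theorem PF.of_word_eq {f : α → β} (h : ∀ a, word (f a) = word a) : PF f :=
  ⟨.skip, 1, fun a m => by rw [h]; exact .skip (by simp)⟩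

@[fun_prop]
theorem PF.cons {f : α → β} {g : α → List β} (hf : PF f) (hg : PF g) :
    PF (fun a => f a :: g a) :=
  (PF.of_word_eq (f := fun x : β × List β => x.1 :: x.2) fun _ => rfl).comp (hf.pair hg)

theorem PF.ite {b : α → Bool} {f g : α → β} (hb : PF b) (hf : PF f) (hg : PF g) :
    PF (fun a => if b a then f a else g a) := by
  obtain ⟨p, P, hp⟩ := hf
  obtain ⟨q, Q, hq⟩ := hg
  obtain ⟨r, R, hr⟩ := hb.pair PF.id
  refine ⟨r ;; .pop .main ;; .case .main fun o =>
      match o with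
      | some true => .pop .main ;; .pop .main ;; .pop .main ;; p
      | _ => .pop .main ;; q,
    R + P + Q + 5, fun a m => ?_⟩
  refine .seq (n₂ := (P + Q + 5).eval (sz a)) (hr a m) ?_ (by simp; omega)
  beta_reduce
  rcases b a with _ | _
  · refine .seq (n₁ := 1) (s₁ := onMain (false :: (word a ++ m)))
      (.pop' (by simp [onMain, word_pair, store]; rfl)) (.case (n := Q.eval (sz a) + 1) ?_ le_rfl)
      (by simp; omega)
    exact .seq (n₁ := 1) (n₂ := Q.eval (sz a)) (.pop' (by simp [onMain, store])) (hq a m)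
      (by omega)
  -- The code of the Boolean `true` is that of a node with two leaves, hence three symbols have to
  -- be removed; that of `false` is a single symbol.
  · refine .seq (n₁ := 1) (s₁ := onMain (true :: false :: false :: (word a ++ m)))
      (.pop' (by simp [onMain, word_pair, store]; rfl)) (.case (n := P.eval (sz a) + 3) ?_ le_rfl)
      (by simp; omega)
    refine .seq (n₁ := 1) (n₂ := P.eval (sz a) + 2)
      (s₁ := onMain (false :: false :: (word a ++ m))) (.pop' (by simp [onMain, store])) ?_
      (by omega)
    refine .seq (n₁ := 1) (n₂ := P.eval (sz a) + 1)
      (s₁ := onMain (false :: (word a ++ m))) (.pop' (by simp [onMain, store])) ?_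
      (by omega)
    exact .seq (n₁ := 1) (n₂ := P.eval (sz a)) (.pop' (by simp [onMain, store])) (hp a m) (by omega)

theorem PF.listCases {l : α → List β} {f : α → γ} {g : (β × List β) × α → γ} (hl : PF l)
    (hf : PF f) (hg : PF g) :
    PF (fun a => match l a with
      | [] => f a
      | b :: t => g ((b, t), a)) := by
  obtain ⟨S, hS⟩ := hl.sizeBdd
  obtain ⟨p, P, hp⟩ := hf
  obtain ⟨q, Q, hq⟩ := hg
  obtain ⟨r, R, hr⟩ := hl.pair PF.id
  refine ⟨r ;; .pop .main ;; .case .main fun o =>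
      match o with
      | some true => .push .main true ;; q
      | _ => .pop .main ;; p,
    R + P + Q.comp (S + Polynomial.X + 1) + 5, fun a m => ?_⟩
  refine .seq (n₂ := (P + Q.comp (S + Polynomial.X + 1) + 5).eval (sz a)) (hr a m) ?_
    (by simp; omega)
  have hSa := hS a
  beta_reduce
  rcases hla : l a with _ | ⟨b, t⟩
  · refine .seq (n₁ := 1) (s₁ := onMain (false :: (word a ++ m)))
      (.pop' (by simp [onMain, word_pair, store]; rfl)) (.case (n := P.eval (sz a) + 1) ?_ le_rfl)
      (by simp; omega)
    exact .seq (n₁ := 1) (n₂ := P.eval (sz a)) (.pop' (by simp [onMain, store])) (hp a m) (by omega)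
  · rw [hla] at hSa
    refine .seq (n₁ := 1) (s₁ := onMain (word (b, t) ++ (word a ++ m)))
      (.pop' (by simp [onMain, word_pair, store, word_cons]))
      (.case (n := Q.eval (sz ((b, t), a)) + 1) ?_ le_rfl) ?_
    · exact .seq (n₁ := 1) (n₂ := Q.eval (sz ((b, t), a))) (s₁ := onMain (word ((b, t), a) ++ m))
        (.push' (by simp [onMain, word_pair, store])) (hq _ m) (by omega)
    · have := eval_mono Q (show sz ((b, t), a) ≤ S.eval (sz a) + sz a + 1 by simp at hSa ⊢; omega)
      simp [-sz_pair]
      omega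

/-- A fold is computable in polynomial time if its step is and its intermediate values have
polynomially bounded size. -/
theorem PF.foldl_of_prefix {l : γ → List α} {init : γ → σ} {step : γ → σ → α → σ} (hl : PF l)
    (hi : PF init) (hs : PF (fun x : γ × σ × α => step x.1 x.2.1 x.2.2))
    (hB : ∃ P : Polynomial ℕ, ∀ c l', l' <+: l c →
      sz (l'.foldl (step c) (init c)) ≤ P.eval (sz c)) :
    PF (fun c => (l c).foldl (step c) (init c)) := by
  obtain ⟨B, hB⟩ := hB
  obtain ⟨S, hS⟩ := hl.sizeBdd
  obtain ⟨p, P, hp⟩ := hl.pair (PF.id.pair hi)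
  have hG : PF (fun x : (α × List α) × γ × σ => (x.1.2, x.2.1, step x.2.1 x.2.2 x.1.1)) :=
    PF.fst'.snd.pair (PF.snd'.fst.pair
      (hs.comp (PF.snd'.fst.pair (PF.snd'.snd.pair PF.fst'.fst))))
  obtain ⟨g, G, hg⟩ := hG
  obtain ⟨r, R, hr⟩ := (PF.snd' : PF (Prod.snd : γ × σ → σ))
  let L : Prog Alph := .loop .main (fun o => o == some true) (.push .main true ;; g ;; .pop .main)
  -- Loop invariant: on the main stack lie the unread part `l₂` and the pair of the context and the
  -- value after `l₁`. Pushing `true` joins them into one pair, the argument of `g`, and popping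
  -- takes the resulting pair apart. The first symbol of the code of `l₂` is `true` iff `l₂` is
  -- nonempty.
  have hL : ∀ c m (l₂ l₁ : List α), l₁ ++ l₂ = l c →
      L.Run (onMain (word l₂ ++ (word (c, l₁.foldl (step c) (init c)) ++ m)))
        (l₂.length * (G.eval (S.eval (sz c) + (1 + sz c + B.eval (sz c)) + 1) + 3) + 1)
        (onMain (false :: (word (c, (l c).foldl (step c) (init c)) ++ m))) := by
    intro c m l₂
    induction l₂ with
    | nil =>
      intro l₁ h
      rw [List.append_nil] at h
      rw [h]
      exact .loop_done rfl (by simp)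
    | cons a l₂ ih =>
      intro l₁ h
      have ih := ih (l₁ ++ [a]) (by simpa using h)
      have h₁ := hB c l₁ ⟨a :: l₂, h⟩
      have h₂ := hS c
      have h₃ : sz (a :: l₂) ≤ sz (l c) := sz_le_of_suffix ⟨l₁, h⟩
      have h₄ := eval_mono G (show sz ((a, l₂), (c, l₁.foldl (step c) (init c))) ≤
        S.eval (sz c) + (1 + sz c + B.eval (sz c)) + 1 by simp at h₃ ⊢; omega)
      refine .loop_step rfl (.seq (n₁ := 1)
        (s₁ := onMain (word ((a, l₂), (c, l₁.foldl (step c) (init c))) ++ m)) ?_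
        (.seq (n₂ := 1) (hg _ m) ?_ le_rfl) le_rfl) ih ?_
      · exact .push' (by simp [onMain, word_pair, store, word_cons])
      · exact .pop' (by simp [onMain, word_pair, store])
      · simp only [List.length_cons]
        ring_nf at h₄ ⊢
        omega
  refine ⟨p ;; .pop .main ;; L ;; .pop .main ;; r,
    P + (S * (G.comp (S + (1 + Polynomial.X + B) + 1) + 3) + 1) + R.comp (1 + Polynomial.X + B) + 2,
    fun c m => ?_⟩
  have h₁ := hB c _ List.prefix_rfl
  have h₂ := eval_mono R (show sz (c, (l c).foldl (step c) (init c)) ≤ 1 + sz c + B.eval (sz c) by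
    simp; omega)
  have h₃ := Nat.mul_le_mul_right (G.eval (S.eval (sz c) + (1 + sz c + B.eval (sz c)) + 1) + 3)
    ((length_le_sz _).trans (hS c))
  refine .seq (hp c m) (.seq (n₁ := 1) (.pop' ?_) (.seq (hL c m (l c) [] rfl)
    (.seq (n₁ := 1) (.pop' ?_)
      (hr (c, (l c).foldl (step c) (init c)) m) le_rfl) le_rfl) le_rfl) ?_
  · simp [onMain, word_pair, store]
  · simp [onMain, store]
  · simp [-sz_pair]
    omega

theorem foldl_size_le {τ : Type} {step : σ → τ → σ} {s : σ} {l : List τ} {B : ℕ}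
    (h : ∀ s, ∀ a ∈ l, sz (step s a) ≤ sz s + B) : sz (l.foldl step s) ≤ sz s + l.length * B := by
  induction l generalizing s with
  | nil => simp
  | cons a l ih =>
    have h₁ := h s a (by simp)
    have h₂ := ih (s := step s a) fun s b hb => h s b (by simp [hb])
    simp only [List.foldl_cons, List.length_cons]
    nlinarith

/-- A fold is computable in polynomial time if its step is and increases the size only by a
polynomial in the sizes of the context and the list element. -/
theorem PF.foldl {l : γ → List α} {init : γ → σ} {step : γ → σ → α → σ} (hl : PF l)
    (hi : PF init) (hs : PF (fun x : γ × σ × α => step x.1 x.2.1 x.2.2))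
    (hB : ∃ P : Polynomial ℕ, ∀ c s a, sz (step c s a) ≤ sz s + P.eval (sz c + sz a)) :
    PF (fun c => (l c).foldl (step c) (init c)) := by
  refine hl.foldl_of_prefix hi hs ?_
  obtain ⟨P, hP⟩ := hB
  obtain ⟨S, hS⟩ := hl.sizeBdd
  obtain ⟨I, hI⟩ := hi.sizeBdd
  refine ⟨I + S * P.comp (Polynomial.X + S), fun c l' h => ?_⟩
  have h₁ : sz (l'.foldl (step c) (init c)) ≤
      sz (init c) + l'.length * P.eval (sz c + S.eval (sz c)) := by
    refine foldl_size_le fun s a ha => (hP c s a).trans ?_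
    have := eval_mono P (show sz c + sz a ≤ sz c + S.eval (sz c) from
      Nat.add_le_add_left ((sz_le_of_mem (h.subset ha)).trans (hS c)) _)
    omega
  have h₂ := Nat.mul_le_mul_right (P.eval (sz c + S.eval (sz c)))
    ((h.length_le.trans (length_le_sz _)).trans (hS c))
  have h₃ := hI c
  simp
  omega

end closure

section library

variable {α β γ δ σ : Type} [Enc α] [Enc β] [Enc γ] [Enc δ] [Enc σ]

/-! ### Polynomial-time functions on lists and numbers -/

theorem PF.comp₂ {f : α → β → γ} {g : δ → α} {h : δ → β} (hf : PF (fun x : α × β => f x.1 x.2))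
    (hg : PF g) (hh : PF h) : PF (fun a => f (g a) (h a)) :=
  hf.comp (hg.pair hh)

@[fun_prop]
theorem PF.cond {b : α → Bool} {f g : α → β} (hb : PF b) (hf : PF f) (hg : PF g) :
    PF (fun a => bif b a then f a else g a) :=
  (PF.ite hb hf hg).of_eq fun a => by cases b a <;> rfl

@[fun_prop]
theorem PF.and {f g : α → Bool} (hf : PF f) (hg : PF g) : PF (fun a => f a && g a) :=
  (PF.cond hf hg (PF.const false)).of_eq fun a => by cases f a <;> rfl

@[fun_prop]
theorem PF.or {f g : α → Bool} (hf : PF f) (hg : PF g) : PF (fun a => f a || g a) :=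
  (PF.cond hf (PF.const true) hg).of_eq fun a => by cases f a <;> rfl

@[fun_prop]
theorem PF.not {f : α → Bool} (hf : PF f) : PF (fun a => !f a) :=
  (PF.cond hf (PF.const false) (PF.const true)).of_eq fun a => by cases f a <;> rfl

@[fun_prop]
theorem PF.beq_bool {f g : α → Bool} (hf : PF f) (hg : PF g) : PF (fun a => f a == g a) :=
  (PF.cond hf hg hg.not).of_eq fun a => by cases f a <;> simp

@[fun_prop]
theorem PF.reverse {l : γ → List α} (hl : PF l) : PF (fun c => (l c).reverse) := by
  refine (hl.foldl (init := fun _ => ([] : List α)) (step := fun _ s a => a :: s)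
    (PF.const _) (by fun_prop) ⟨Polynomial.X + 1, fun c s a => ?_⟩).of_eq fun c => ?_
  · simp; omega
  · have : ∀ l s : List α, l.foldl (fun s a => a :: s) s = l.reverse ++ s := by
      intro l
      induction l with
      | nil => simp
      | cons a l ih => intro s; simp [ih]
    simp [this (l c) []]

theorem PF.foldr {l : γ → List α} {init : γ → σ} {step : γ → α → σ → σ} (hl : PF l)
    (hi : PF init) (hs : PF (fun x : γ × α × σ => step x.1 x.2.1 x.2.2))
    (hB : ∃ P : Polynomial ℕ, ∀ c a s, sz (step c a s) ≤ sz s + P.eval (sz c + sz a)) :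
    PF (fun c => (l c).foldr (step c) (init c)) := by
  obtain ⟨P, hP⟩ := hB
  refine (hl.reverse.foldl (step := fun c s a => step c a s) hi ?_
    ⟨P, fun c s a => hP c a s⟩).of_eq fun c => by simp
  exact hs.comp (f := fun x : γ × σ × α => (x.1, x.2.2, x.2.1)) (by fun_prop)

theorem PF.map {l : γ → List α} {f : γ → α → β} (hl : PF l)
    (hf : PF (fun x : γ × α => f x.1 x.2)) : PF (fun c => (l c).map (f c)) := by
  obtain ⟨P, hP⟩ := hf.sizeBdd
  refine (hl.foldr (init := fun _ => ([] : List β)) (step := fun c a s => f c a :: s)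
    (PF.const _) ?_ ⟨P.comp (Polynomial.X + 1) + 1, fun c a s => ?_⟩).of_eq fun c => ?_
  · exact (hf.comp₂ (f := fun c a => f c a) PF.fst' PF.snd'.fst).cons PF.snd'.snd
  · have : sz (f c a) ≤ _ := hP (c, a)
    rw [sz_pair] at this
    simp [show sz c + sz a + 1 = 1 + sz c + sz a by omega]
    omega
  · induction l c with
    | nil => rfl
    | cons a l ih => simp [ih]

theorem PF.any {l : γ → List α} {f : γ → α → Bool} (hl : PF l)
    (hf : PF (fun x : γ × α => f x.1 x.2)) : PF (fun c => (l c).any (f c)) := by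
  refine (hl.foldr (init := fun _ => false) (step := fun c a s => f c a || s)
    (PF.const _) ?_ ⟨3, fun c a s => ?_⟩).of_eq fun c => ?_
  · exact (hf.comp₂ (f := fun c a => f c a) PF.fst' PF.snd'.fst).or PF.snd'.snd
  · have := sz_bool_le (f c a || s)
    simp
    omega
  · induction l c with
    | nil => rfl
    | cons a l ih => simp [ih]

theorem PF.all {l : γ → List α} {f : γ → α → Bool} (hl : PF l)
    (hf : PF (fun x : γ × α => f x.1 x.2)) : PF (fun c => (l c).all (f c)) :=
  (PF.any hl (f := fun c a => !f c a) hf.not).not.of_eq fun c => by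
    simp [List.all_eq_not_any_not]

@[fun_prop]
theorem PF.append {f g : γ → List α} (hf : PF f) (hg : PF g) : PF (fun c => f c ++ g c) := by
  refine (hf.foldr (step := fun _ a s => a :: s) hg (by fun_prop)
    ⟨Polynomial.X + 1, fun c a s => ?_⟩).of_eq fun c => ?_
  · simp; omega
  · simp

@[fun_prop]
theorem PF.headD {l : γ → List α} {d : γ → α} (hl : PF l) (hd : PF d) :
    PF (fun c => (l c).headD (d c)) :=
  (hl.listCases (g := fun x : (α × List α) × γ => x.1.1) hd (by fun_prop)).of_eq fun c => by
    cases l c <;> rfl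

@[fun_prop]
theorem PF.tail {l : γ → List α} (hl : PF l) : PF (fun c => (l c).tail) :=
  (hl.listCases (g := fun x : (α × List α) × γ => x.1.2) (PF.const []) (by fun_prop)).of_eq
    fun c => by cases l c <;> rfl

@[fun_prop]
theorem PF.isEmpty {l : γ → List α} (hl : PF l) : PF (fun c => (l c).isEmpty) :=
  (hl.listCases (f := fun _ => true) (g := fun _ => false) (PF.const _) (PF.const _)).of_eq
    fun c => by cases l c <;> rfl

-- Numbers and lists of units have the same code words, which reduces arithmetic to lists: addition
-- is concatenation and truncated subtraction is dropping.
@[fun_prop]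
theorem PF.units {n : γ → ℕ} (hn : PF n) : PF (fun c => List.replicate (n c) ()) :=
  (PF.of_word_eq (f := fun n : ℕ => List.replicate n ()) fun _ => rfl).comp hn

@[fun_prop]
theorem PF.length {l : γ → List α} (hl : PF l) : PF (fun c => (l c).length) := by
  have h : PF (fun l : List Unit => l.length) := PF.of_word_eq fun l => by
    have : List.replicate l.length () = l :=
      (List.eq_replicate_iff.2 ⟨rfl, fun _ _ => rfl⟩).symm
    exact congrArg word this
  exact (h.comp (hl.map (f := fun _ _ => ()) (PF.const _))).of_eq fun c => by simp

@[fun_prop]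
theorem PF.drop {n : γ → ℕ} {l : γ → List α} (hn : PF n) (hl : PF l) :
    PF (fun c => (l c).drop (n c)) := by
  refine (hn.units.foldl (step := fun _ s _ => s.tail) hl (by fun_prop)
    ⟨0, fun c s a => ?_⟩).of_eq fun c => ?_
  · simpa using sz_le_of_suffix s.tail_suffix
  · induction n c generalizing l with
    | zero => simp
    | succ n ih => 
      rw [List.replicate_succ, List.foldl_cons, ih (l := fun c => (l c).tail) hl.tail]
      simp

@[fun_prop]
theorem PF.getD {l : γ → List α} {n : γ → ℕ} {d : γ → α} (hl : PF l) (hn : PF n) (hd : PF d) :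
    PF (fun c => (l c).getD (n c) (d c)) :=
  ((hn.drop hl).headD hd).of_eq fun c => by
    simp [List.headD_eq_head?_getD, List.head?_drop]

@[fun_prop]
theorem PF.getLastD {l : γ → List α} {d : γ → α} (hl : PF l) (hd : PF d) :
    PF (fun c => (l c).getLastD (d c)) :=
  (hl.reverse.headD hd).of_eq fun c => by
    simp [List.headD_eq_head?_getD, List.getLastD_eq_getLast?]

@[fun_prop]
theorem PF.add {f g : γ → ℕ} (hf : PF f) (hg : PF g) : PF (fun c => f c + g c) :=
  (hf.units.append hg.units).length.of_eq fun c => by simp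

@[fun_prop]
theorem PF.sub {f g : γ → ℕ} (hf : PF f) (hg : PF g) : PF (fun c => f c - g c) :=
  (hg.drop hf.units).length.of_eq fun c => by simp

@[fun_prop]
theorem PF.mul {f g : γ → ℕ} (hf : PF f) (hg : PF g) : PF (fun c => f c * g c) := by
  obtain ⟨P, hP⟩ := hg.sizeBdd
  refine (hf.units.foldl (init := fun _ => 0) (step := fun c s _ => s + g c) (PF.const 0)
    ?_ ⟨P, fun c s a => ?_⟩).of_eq fun c => ?_
  · have := hg.comp (PF.fst' : PF (Prod.fst : γ × ℕ × Unit → γ))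
    fun_prop
  · have h₁ := (hP c).trans (eval_mono P (Nat.le_add_right (sz c) (sz a)))
    simp at h₁ ⊢
    omega
  · induction f c with
    | zero => simp
    | succ n ih => rw [List.replicate_succ', List.foldl_append, ih]; simp [Nat.succ_mul]

@[fun_prop]
theorem PF.min {f g : γ → ℕ} (hf : PF f) (hg : PF g) : PF (fun c => min (f c) (g c)) :=
  (hf.sub (hf.sub hg)).of_eq fun c => by omega

@[fun_prop]
theorem PF.ble {f g : γ → ℕ} (hf : PF f) (hg : PF g) : PF (fun c => Nat.ble (f c) (g c)) :=
  (hf.sub hg).units.isEmpty.of_eq fun c => by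
    rw [Bool.eq_iff_iff, Nat.ble_eq]
    simp
    omega

@[fun_prop]
theorem PF.beq_nat {f g : γ → ℕ} (hf : PF f) (hg : PF g) : PF (fun c => f c == g c) :=
  ((hf.ble hg).and (hg.ble hf)).of_eq fun c => by
    rw [Bool.eq_iff_iff, Bool.and_eq_true, Nat.ble_eq, Nat.ble_eq, beq_iff_eq]
    omega

-- The appended number depends on the accumulator, so its growth is not controlled by context and
-- list element as `PF.foldl` requires. The intermediate values are themselves ranges, however, with
-- at most `P` entries of size at most `2 * P + 1`.
@[fun_prop]
theorem PF.range {n : γ → ℕ} (hn : PF n) : PF (fun c => List.range (n c)) := by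
  have h : ∀ m, (List.replicate m ()).foldl (fun (s : List ℕ) _ => s ++ [s.length]) [] =
      List.range m := by
    intro m
    induction m with
    | zero => rfl
    | succ m ih => rw [List.replicate_succ', List.foldl_append, ih]; simp [List.range_succ]
  obtain ⟨P, hP⟩ := hn.sizeBdd
  refine (hn.units.foldl_of_prefix (init := fun _ => ([] : List ℕ))
    (step := fun _ s _ => s ++ [s.length]) (PF.const _) (by fun_prop)
    ⟨P * (2 * P + 2) + 1, fun c l' hl' => ?_⟩).of_eq fun c => h _
  have h₁ : l' = List.replicate l'.length () := by simp [List.eq_replicate_iff]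
  have h₂ := hl'.length_le
  have h₃ := hP c
  rw [h₁, h]
  simp only [List.length_replicate, sz_nat] at h₂ h₃
  have h₄ : sz (List.range l'.length) ≤ l'.length * ((2 * P.eval (sz c) + 1) + 1) + 1 := by
    have := sz_list_le (l := List.range l'.length) (B := 2 * P.eval (sz c) + 1) fun a ha => by
      simp at ha ⊢
      omega
    simpa using this
  refine h₄.trans ?_
  simp
  exact Nat.mul_le_mul_right _ (by omega)

/-! ### Finite types -/

/-- A number that stands for an element of a finite type. -/
noncomputable def finIndex {τ : Type} [Fintype τ] (a : τ) : ℕ := Fintype.equivFin τ a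

theorem finIndex_inj {τ : Type} [Fintype τ] {a b : τ} : finIndex a = finIndex b ↔ a = b := by
  simp [finIndex, Fin.val_inj]

/-- The index of `g c` is compared with that of each of the finitely many elements of `τ`, and each
outcome has its own program. So only the dependence on `c` for fixed `a` has to be computable. -/
theorem PF.finCases {τ : Type} [Fintype τ] [Enc τ] (hw : ∀ a : τ, word a = word (finIndex a))
    {f : γ → τ → β} {g : γ → τ} (hf : ∀ a, PF (fun c => f c a)) (hg : PF g) :
    PF (fun c => f c (g c)) := by
  have hi : PF (fun c => finIndex (g c)) := 
    (PF.of_word_eq (f := fun a : τ => finIndex a) fun a => (hw a).symm).comp hg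
  have key : ∀ (L : List τ) (a₀ : τ),
      PF (fun c => f c ((L.find? fun a => finIndex (g c) == finIndex a).getD a₀)) := by
    intro L a₀
    induction L with
    | nil => exact hf a₀
    | cons a L ih =>
      refine ((hi.beq_nat (PF.const (finIndex a))).cond (hf a) ih).of_eq fun c => ?_
      rw [List.find?_cons]
      cases finIndex (g c) == finIndex a <;> rfl
  -- A point of `γ` provides the default element for the search, which is never used since `g c` is
  -- found; without points any program will do.
  rcases isEmpty_or_nonempty γ with hγ | ⟨⟨c₀⟩⟩
  · exact ⟨.skip, 0, fun a => hγ.elim a⟩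
  · refine (key Finset.univ.toList (g c₀)).of_eq fun c => ?_
    have : ((Finset.univ : Finset τ).toList.find? fun a => finIndex (g c) == finIndex a) =
        some (g c) := by
      cases h : (Finset.univ : Finset τ).toList.find? fun a => finIndex (g c) == finIndex a with
      | none => exact absurd (List.find?_eq_none.1 h (g c) (by simp)) (by simp)
      | some b =>
        have := List.find?_some h
        simp only [beq_iff_eq, finIndex_inj] at this
        rw [this]
    rw [this]
    rfl

end library

/-! ### From polynomial-time functions to machines -/

instance : Fintype Letter :=
  ⟨⟨↑([.bit true, .bit false, .comma, .semicolon, .close, .inp, .not, .and, .or, .all] :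
    List Letter), by simp⟩, by
    intro a
    rcases a with (_ | _) | _ | _ | _ | _ | _ | _ | _ | _ <;> simp⟩

noncomputable instance : Enc Letter := ⟨fun a => Enc.toData (finIndex a)⟩

noncomputable instance : Enc Sym := ⟨fun a => Enc.toData (finIndex a)⟩

instance : ∀ r, Fintype (Alph r)
  | .inp => inferInstanceAs (Fintype Sym)
  | .out => inferInstanceAs (Fintype Bool)
  | .main => inferInstanceAs (Fintype Bool)
  | .aux₁ => inferInstanceAs (Fintype (Option Bool))
  | .aux₂ => inferInstanceAs (Fintype (Option Bool))
  | .count => inferInstanceAs (Fintype Bool)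

theorem exists_sz_sym_le : ∃ B, ∀ a : Sym, sz a ≤ B :=
  ⟨∑ a : Sym, sz a, fun a => Finset.single_le_sum (f := fun a => sz a) (by simp) (by simp)⟩

/-- The body of the loop that reads the input. -/
noncomputable def readBody : Prog Alph :=
  .case .inp fun o =>
    match o with
    | some x => .pop .inp ;; pushWord (word x) ;; .push .main true
    | none => .skip

/-- Putting `true` and the code of `x` before the code of `acc` yields the code of `x :: acc`, so
the input arrives on the main stack in reverse order. -/
theorem run_readLoop {B : ℕ} (hB : ∀ a : Sym, sz a ≤ B) (i acc : List Sym) :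
    (Prog.loop .inp Option.isSome readBody).Run (store i [] (word acc) [] [] [])
      (i.length * (B + 5) + 1) (store [] [] (word (i.reverse ++ acc)) [] [] []) := by
  induction i generalizing acc with
  | nil => exact .loop_done rfl (by simp)
  | cons x i ih =>
    refine .loop_step (n₁ := B + 4) rfl (.case (n := B + 3) ?_ le_rfl)
      (by simpa using ih (x :: acc)) (by simp; ring_nf; omega)
    refine .seq (n₁ := 1) (n₂ := B + 2) (.pop' (update_inp ..)) 
      (.seq (n₂ := 1) (run_pushWord _ _ _ _ _ _ _) (.push' (update_main ..)) (Nat.add_le_add_right (Nat.add_le_add_right (hB x) 1) 1)) (by omega)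

/-- Write a Boolean value on the output stack. -/
def writeBool : Prog Alph :=
  .case .main fun o =>
    match o with
    | some true => .pop .main ;; .pop .main ;; .pop .main ;; .push .out true
    | _ => .pop .main ;; .push .out false

theorem run_writeBool (b : Bool) :
    writeBool.Run (onMain (word b)) 5 (store [] [b] [] [] [] []) := by
  refine .case (n := 4) ?_ le_rfl
  cases b
  · exact .seq (n₁ := 1) (n₂ := 1) (.pop' (update_main ..)) (.push' (update_out ..)) (by omega)
  · exact .seq (n₁ := 1) (n₂ := 3) (.pop' (update_main ..)) (.seq (n₁ := 1) (n₂ := 2)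
      (.pop' (update_main ..)) (.seq (n₁ := 1) (n₂ := 1) (.pop' (update_main ..))
        (.push' (update_out ..)) le_rfl) le_rfl) le_rfl

theorem PF.polyTimeDecidable {W : List Sym → Bool} (hW : PF W) :
    PolyTimeDecidable encTuple
      (fun w : List Letter × List (List Bool) => W (encTuple w) = true) := by
  obtain ⟨B, hB⟩ := exists_sz_sym_le
  -- The reversal undoes the one caused by reading the input.
  obtain ⟨p, P, hp⟩ := hW.comp (PF.id : PF fun l : List Sym => l).reverse
  refine polyTimeDecidable_of_run (Γ := Alph) (k₀ := .inp) (k₁ := .out) (Equiv.refl Bool) encTuple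
    (fun w => W (encTuple w))
    (.push .main false ;; .loop .inp Option.isSome readBody ;; p ;; writeBool)
    ((Polynomial.C (B + 5) * Polynomial.X + 1) +
      P.comp (Polynomial.C (B + 1) * Polynomial.X + 1) + 6) fun w => ?_
  rw [store_nil, update_inp, update_out]
  have h := hp (encTuple w).reverse []
  simp only [List.append_nil, List.reverse_reverse] at h
  have h₁ := run_readLoop hB (encTuple w) []
  rw [List.append_nil] at h₁
  refine .seq (n₁ := 1) (.push' (update_main ..)) (.seq h₁ (.seq h (run_writeBool _) le_rfl)
    le_rfl) ?_
  have h₂ : sz (encTuple w).reverse ≤ (B + 1) * (encTuple w).length + 1 := by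
    have := sz_list_le (l := (encTuple w).reverse) (B := B) fun a _ => hB a
    simpa [mul_comm] using this
  have h₃ := eval_mono P h₂
  have h₄ := mul_comm (B + 5) (encTuple w).length
  simp at h₃ ⊢
  omega

/-! ### The decision procedure -/

section procedure

variable {γ : Type} [Enc γ]

theorem exists_sz_le (τ : Type) [Fintype τ] [Enc τ] : ∃ B, ∀ a : τ, sz a ≤ B :=
  ⟨∑ a : τ, sz a, fun a => Finset.single_le_sum (f := fun a => sz a) (by simp) (by simp)⟩

/-- Two letters are equal. -/
noncomputable def Letter.is (a b : Letter) : Bool := finIndex a == finIndex b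

theorem Letter.is_iff {a b : Letter} : a.is b = true ↔ a = b := by
  simp [Letter.is, finIndex_inj]

@[fun_prop]
theorem PF.is {f g : γ → Letter} (hf : PF f) (hg : PF g) : PF (fun c => (f c).is (g c)) :=
  have h : PF (fun a : Letter => finIndex a) := PF.of_word_eq fun _ => rfl
  (h.comp hf).beq_nat (h.comp hg)

/-- One step of splitting a tuple into its components, from the right to the left. -/
def splitStep (a : Sym) (s : List Letter × List (List Bool) × List Bool) :
    List Letter × List (List Bool) × List Bool :=
  match a with
  | some (Sum.inl x) => (x :: s.1, s.2)
  | some (Sum.inr b) => (s.1, s.2.1, b :: s.2.2)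
  | none => (s.1, s.2.2 :: s.2.1, [])

/-- The components of a tuple. -/
def splitTuple (w : List Sym) : List Letter × List (List Bool) × List Bool :=
  w.foldr splitStep ([], [], [])

@[fun_prop]
theorem PF.splitTuple {w : γ → List Sym} (hw : PF w) : PF (fun c => splitTuple (w c)) := by
  obtain ⟨B, hB⟩ := exists_sz_le Letter
  refine hw.foldr (step := fun _ => splitStep) (PF.const _) ?_
    ⟨Polynomial.C (B + 4), fun c a s => ?_⟩
  · refine PF.finCases (fun _ => rfl)
      (f := fun (x : γ × Sym × List Letter × List (List Bool) × List Bool) a => splitStep a x.2.2)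
      (fun a => ?_) (by fun_prop)
    rcases a with _ | x | b <;> simp only [splitStep] <;> fun_prop
  · obtain ⟨ls, ys, y⟩ := s
    rcases a with _ | x | b
    · simp [splitStep]; omega
    · have := hB x
      simp [splitStep]; omega
    · have := sz_bool_le b
      simp [splitStep]; omega

/-- The segments of a word between the occurrences of a separator. -/
noncomputable def segments (sep : Letter) (l : List Letter) : List Letter × List (List Letter) :=
  l.foldr (fun a s => bif a.is sep then ([], s.1 :: s.2) else (a :: s.1, s.2)) ([], [])

@[fun_prop]
theorem PF.segments {sep : Letter} {l : γ → List Letter} (hl : PF l) :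
    PF (fun c => segments sep (l c)) := by
  refine hl.foldr (step := fun _ a s => bif a.is sep then ([], s.1 :: s.2) else (a :: s.1, s.2))
    (PF.const _) (by fun_prop) ⟨Polynomial.X + 2, fun c a s => ?_⟩
  obtain ⟨s, t⟩ := s
  cases a.is sep <;> simp <;> omega

/-- The segments of a word in which every segment is followed by the separator. -/
noncomputable def terms (sep : Letter) (l : List Letter) : List (List Letter) :=
  ((segments sep l).1 :: (segments sep l).2).reverse.tail.reverse

@[fun_prop]
theorem PF.terms {sep : Letter} {l : γ → List Letter} (hl : PF l) :
    PF (fun c => terms sep (l c)) := by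
  unfold BFDS.terms
  fun_prop

/-- The number that is given in binary, cut off at `N`. -/
noncomputable def readNat (N : ℕ) (l : List Letter) : ℕ :=
  l.foldr (fun a s => min N (bif a.is (.bit true) then s + s + 1 else s + s)) 0

-- Without the cut-off the value could be exponential in the length of `l`. With it, each
-- intermediate value is at most `N`, which is part of the context.
@[fun_prop]
theorem PF.readNat {N : γ → ℕ} {l : γ → List Letter} (hN : PF N) (hl : PF l) :
    PF (fun c => readNat (N c) (l c)) := by
  have h : PF (fun x : ℕ × List Letter => BFDS.readNat x.1 x.2) := by
    refine PF.foldr (l := fun x : ℕ × List Letter => x.2) (init := fun _ => 0)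
      (step := fun x a s => Min.min x.1 (bif a.is (.bit true) then s + s + 1 else s + s))
      (by fun_prop) (PF.const 0) (by fun_prop)
      ⟨Polynomial.X, fun c a s => ?_⟩
    obtain ⟨N, l⟩ := c
    simp
    omega
  exact h.comp₂ hN hl

/-- A list of numbers, cut off at `N`. -/
noncomputable def readNats (N : ℕ) (l : List Letter) : List ℕ :=
  (terms .comma l).map (readNat N)

@[fun_prop]
theorem PF.readNats {N : γ → ℕ} {l : γ → List Letter} (hN : PF N) (hl : PF l) :
    PF (fun c => readNats (N c) (l c)) := by
  refine PF.map (f := fun c => BFDS.readNat (N c)) ?_ ?_ <;> fun_prop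

/-- A gate, as its type and the list of its arguments. -/
abbrev RawGate : Type := Letter × List ℕ

/-- An instance, as the number of choices, the circuits, the schedule, and the
two configurations. -/
abbrev RawInstance : Type :=
  ℕ × List (List RawGate) × (Bool × List (List ℕ)) × List Bool × List Bool

/-- A gate from its encoding. -/
noncomputable def readGate (N : ℕ) (l : List Letter) : RawGate :=
  (l.headD .all, readNats N l.tail)

/-- A circuit from its encoding. -/
noncomputable def readCircuit (N : ℕ) (l : List Letter) : List RawGate :=
  (terms .semicolon l).map (readGate N)

/-- A schedule from its encoding. -/
noncomputable def readSchedule (N : ℕ) (l : List Letter) : Bool × List (List ℕ) :=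
  ((l.headD .close).is .all, (terms .semicolon l).map (readNats N))

/-- A configuration from its encoding. -/
noncomputable def readConfig (l : List Letter) : List Bool := l.map fun a => a.is (.bit true)

@[fun_prop]
theorem PF.readGate {N : γ → ℕ} {l : γ → List Letter} (hN : PF N) (hl : PF l) :
    PF (fun c => readGate (N c) (l c)) := by
  unfold BFDS.readGate
  fun_prop

@[fun_prop]
theorem PF.readCircuit {N : γ → ℕ} {l : γ → List Letter} (hN : PF N) (hl : PF l) :
    PF (fun c => readCircuit (N c) (l c)) := by
  refine PF.map (f := fun c => BFDS.readGate (N c)) ?_ ?_ <;> fun_prop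

@[fun_prop]
theorem PF.readSchedule {N : γ → ℕ} {l : γ → List Letter} (hN : PF N) (hl : PF l) :
    PF (fun c => readSchedule (N c) (l c)) := by
  refine PF.pair (by fun_prop) (PF.map (f := fun c => BFDS.readNats (N c)) ?_ ?_) <;> fun_prop

@[fun_prop]
theorem PF.readConfig {l : γ → List Letter} (hl : PF l) : PF (fun c => readConfig (l c)) := by
  refine PF.map (f := fun _ (a : Letter) => a.is (.bit true)) ?_ ?_ <;> fun_prop

/-- The length of the encoding of the two numbers at the beginning of an instance, and the second
of them. -/
noncomputable def readSizes (x : List Letter) : ℕ × ℕ :=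
  ((segments .comma x).1.length + ((segments .comma x).2.headD []).length + 2,
    ((segments .comma x).2.headD []).length)

/-- An instance from the two numbers, the list of the last parts of its encoding in reverse order,
and the bound on numbers. -/
noncomputable def readParts (N k : ℕ) (l : List (List Letter)) : RawInstance :=
  (k, l.tail.tail.reverse.map (readCircuit N), readSchedule N (l.tail.headD []),
    readConfig (segments .semicolon (l.headD [])).1,
    readConfig ((segments .semicolon (l.headD [])).2.headD []))

/-- An instance from its encoding. -/
noncomputable def readInstance (x : List Letter) : RawInstance :=
  readParts x.length (readSizes x).2
    ((segments .close (x.drop (readSizes x).1)).1 ::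
      (segments .close (x.drop (readSizes x).1)).2).reverse

@[fun_prop]
theorem PF.readParts {N k : γ → ℕ} {l : γ → List (List Letter)} (hN : PF N) (hk : PF k)
    (hl : PF l) : PF (fun c => readParts (N c) (k c) (l c)) := by
  refine hk.pair (PF.pair (PF.map (f := fun c => BFDS.readCircuit (N c)) ?_ ?_) ?_) <;> fun_prop

@[fun_prop]
theorem PF.readInstance {l : γ → List Letter} (hl : PF l) :
    PF (fun c => readInstance (l c)) := by
  unfold BFDS.readInstance
  fun_prop

/-- The value of a gate. -/
def gateVal (x v : List Bool) (g : RawGate) : Bool :=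
  match g.1 with
  | .inp => x.getD (g.2.headD 0) false
  | .not => !(v.getD (g.2.headD 0) false)
  | .and => g.2.all fun a => v.getD a false
  | .or => g.2.any fun a => v.getD a false
  | _ => false

@[fun_prop]
theorem PF.gateVal {x v : γ → List Bool} {g : γ → RawGate} (hx : PF x) (hv : PF v) (hg : PF g) :
    PF (fun c => gateVal (x c) (v c) (g c)) := by
  refine PF.finCases (fun _ => rfl) (f := fun c a => BFDS.gateVal (x c) (v c) (a, (g c).2))
    (fun a => ?_) hg.fst
  rcases a with _ | _ | _ | _ | _ | _ | _ | _ | _ <;> simp only [BFDS.gateVal]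
  case and => refine PF.all (f := fun c a => (v c).getD a false) ?_ ?_ <;> fun_prop
  case or => refine PF.any (f := fun c a => (v c).getD a false) ?_ ?_ <;> fun_prop
  all_goals fun_prop

/-- The value of a circuit. -/
def circVal (C : List RawGate) (x : List Bool) : Bool :=
  (C.foldl (fun v g => v ++ [gateVal x v g]) []).getLastD false

@[fun_prop]
theorem PF.circVal {C : γ → List RawGate} {x : γ → List Bool} (hC : PF C) (hx : PF x) :
    PF (fun c => circVal (C c) (x c)) := by
  refine (hC.foldl (init := fun _ => []) (step := fun c v g => v ++ [BFDS.gateVal (x c) v g])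
    (PF.const _) (by fun_prop) ⟨4, fun c s a => ?_⟩).getLastD (PF.const _)
  have h₁ := sz_append s [BFDS.gateVal (x c) s a]
  have h₂ := sz_bool_le (BFDS.gateVal (x c) s a)
  simp at h₁ ⊢
  omega

/-- Some update function of node `i` has the value `b` at `x`. -/
def canBecome (I : RawInstance) (x : List Bool) (i : ℕ) (b : Bool) : Bool :=
  (List.range I.1).any fun j => circVal (I.2.1.getD (i * I.1 + j) []) x == b

@[fun_prop]
theorem PF.canBecome {I : γ → RawInstance} {x : γ → List Bool} {i : γ → ℕ} {b : γ → Bool}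
    (hI : PF I) (hx : PF x) (hi : PF i) (hb : PF b) :
    PF (fun c => canBecome (I c) (x c) (i c) (b c)) := by
  refine PF.any (f := fun c j => BFDS.circVal ((I c).2.1.getD (i c * (I c).1 + j) []) (x c) == b c)
    ?_ ?_ <;> fun_prop

/-- Replace the `i`-th entry of a list. -/
def setAt (l : List Bool) (i : ℕ) (b : Bool) : List Bool :=
  (List.range l.length).map fun m => bif m == i then b else l.getD m false

theorem length_setAt (l : List Bool) (i : ℕ) (b : Bool) : (setAt l i b).length = l.length := by
  simp [setAt]

@[fun_prop]
theorem PF.setAt {l : γ → List Bool} {i : γ → ℕ} {b : γ → Bool} (hl : PF l) (hi : PF i)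
    (hb : PF b) : PF (fun c => setAt (l c) (i c) (b c)) := by
  refine PF.map (f := fun c m => bif m == i c then b c else (l c).getD m false) ?_ ?_ <;> fun_prop

/-- The update of node `i` in a step towards `d`; the second component says whether all updates
have been possible. -/
def stepTo (I : RawInstance) (d : List Bool) (s : List Bool × Bool) (i : ℕ) : List Bool × Bool :=
  (setAt s.1 i (d.getD i false), s.2 && canBecome I s.1 i (d.getD i false))

/-- The sequence `l` of updates can lead from `c` to `d`. -/
def canStep (I : RawInstance) (l : List ℕ) (c d : List Bool) : Bool :=
  (l.foldl (stepTo I d) (c, true)).2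

@[fun_prop]
theorem PF.canStep {I : γ → RawInstance} {l : γ → List ℕ} {x y : γ → List Bool}
    (hI : PF I) (hl : PF l) (hx : PF x) (hy : PF y) :
    PF (fun c => canStep (I c) (l c) (x c) (y c)) := by
  refine (hl.foldl_of_prefix (init := fun c => (x c, true)) (step := fun c => stepTo (I c) (y c))
    (by fun_prop) (by unfold stepTo; fun_prop) ?_).snd
  obtain ⟨P, hP⟩ := hx.sizeBdd
  -- The updates preserve the length of the configuration. Each entry contributes at most 3 for its
  -- code and 1 for the list cell; the rest is the end of the list, the Boolean and the pair.
  refine ⟨4 * P + 5, fun c l' _ => ?_⟩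
  have h : ∀ (l : List ℕ) s, (l.foldl (stepTo (I c) (y c)) s).1.length = s.1.length := by
    intro l
    induction l with
    | nil => simp
    | cons i l ih => intro s; rw [List.foldl_cons, ih]; exact length_setAt ..
  have h₁ := h l' (x c, true)
  have h₂ := sz_list_le (B := 3) (fun b (_ : b ∈ (l'.foldl (stepTo (I c) (y c)) (x c, true)).1) =>
    sz_bool_le b)
  have h₃ := (length_le_sz _).trans (hP c)
  have h₄ := sz_bool_le (l'.foldl (stepTo (I c) (y c)) (x c, true)).2
  have h₅ := sz_pair (l'.foldl (stepTo (I c) (y c)) (x c, true)).1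
    (l'.foldl (stepTo (I c) (y c)) (x c, true)).2
  rw [Prod.mk.eta] at h₅
  simp at h₁ ⊢
  omega

/-- At all configurations that arise from `x` by setting `q` entries to those of `c` or `d`, but
never the `i`-th one to that of `d`, node `i` can get the value that it has in `d`. -/
def canAlways (I : RawInstance) (c d : List Bool) (i : ℕ) : ℕ → List Bool → Bool
  | 0, x => canBecome I x i (d.getD i false)
  | q + 1, x => (List.range d.length).all fun m =>
      canAlways I c d i q (setAt x m (c.getD m false)) &&
        (m == i || canAlways I c d i q (setAt x m (d.getD m false)))

-- The number `q` of nested changes is fixed, so this is a nesting of `q` polynomial-time tests over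
-- all nodes; its running time is exponential only in `q`.
@[fun_prop]
theorem PF.canAlways {I : γ → RawInstance} {c d x : γ → List Bool} {i : γ → ℕ} (q : ℕ)
    (hI : PF I) (hc : PF c) (hd : PF d) (hi : PF i) (hx : PF x) :
    PF (fun a => canAlways (I a) (c a) (d a) (i a) q (x a)) := by
  have h : ∀ q, PF (fun a : RawInstance × List Bool × List Bool × ℕ × List Bool =>
      BFDS.canAlways a.1 a.2.1 a.2.2.1 a.2.2.2.1 q a.2.2.2.2) := by
    intro q
    induction q with
    | zero => simp only [BFDS.canAlways]; fun_prop
    | succ q ih =>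
      refine PF.all (f := fun (a : RawInstance × List Bool × List Bool × ℕ × List Bool) m =>
        BFDS.canAlways a.1 a.2.1 a.2.2.1 a.2.2.2.1 q
            (BFDS.setAt a.2.2.2.2 m (a.2.1.getD m false)) &&
          (m == a.2.2.2.1 || BFDS.canAlways a.1 a.2.1 a.2.2.1 a.2.2.2.1 q
            (BFDS.setAt a.2.2.2.2 m (a.2.2.1.getD m false)))) (by fun_prop) ?_
      refine PF.and ?_ (PF.or (by fun_prop) ?_)
      · exact ih.comp (f := fun b : (RawInstance × List Bool × List Bool × ℕ × List Bool) × ℕ =>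
          (b.1.1, b.1.2.1, b.1.2.2.1, b.1.2.2.2.1,
            BFDS.setAt b.1.2.2.2.2 b.2 (b.1.2.1.getD b.2 false))) (by fun_prop)
      · exact ih.comp (f := fun b : (RawInstance × List Bool × List Bool × ℕ × List Bool) × ℕ =>
          (b.1.1, b.1.2.1, b.1.2.2.1, b.1.2.2.2.1,
            BFDS.setAt b.1.2.2.2.2 b.2 (b.1.2.2.1.getD b.2 false))) (by fun_prop)
  exact (h q).comp (f := fun a => (I a, c a, d a, i a, x a)) (by fun_prop)

/-- The least or greatest configuration between `c` and `d`, but with the `i`-th entry of `c`. -/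
def extremePoint (c d : List Bool) (i : ℕ) : List Bool :=
  (List.range d.length).map fun m =>
    bif m == i then c.getD m false
    else bif d.getD i false then c.getD m false && d.getD m false
    else c.getD m false || d.getD m false

@[fun_prop]
theorem PF.extremePoint {x y : γ → List Bool} {i : γ → ℕ} (hx : PF x) (hy : PF y) (hi : PF i) :
    PF (fun c => extremePoint (x c) (y c) (i c)) := by
  refine PF.map (f := fun c m => bif m == i c then (x c).getD m false
    else bif (y c).getD (i c) false then (x c).getD m false && (y c).getD m false
    else (x c).getD m false || (y c).getD m false) ?_ ?_ <;> fun_prop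

/-- The test for the last time step. -/
def lastStep (q : ℕ) (I : RawInstance) (c : List Bool) : Bool :=
  bif I.2.2.1.1 then
    (List.range I.2.2.2.2.length).all fun i =>
      canAlways I c I.2.2.2.2 i q (extremePoint c I.2.2.2.2 i)
  else I.2.2.1.2.all fun l => canStep I l c I.2.2.2.2

@[fun_prop]
theorem PF.lastStep {I : γ → RawInstance} {x : γ → List Bool} (q : ℕ) (hI : PF I) (hx : PF x) :
    PF (fun c => lastStep q (I c) (x c)) := by
  refine PF.cond (by fun_prop) ?_ ?_
  · refine PF.all (f := fun c i => BFDS.canAlways (I c) (x c) (I c).2.2.2.2 i q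
      (BFDS.extremePoint (x c) (I c).2.2.2.2 i)) ?_ ?_ <;> fun_prop
  · refine PF.all (f := fun c l => BFDS.canStep (I c) l (x c) (I c).2.2.2.2) ?_ ?_ <;> fun_prop

/-- The list of numbers that is given in unary by a binary string. -/
def unaryNats (y : List Bool) : List ℕ :=
  y.foldr (fun b s =>
    bif b then (bif s.isEmpty then [] else (s.headD 0 + 1) :: s.tail) else 0 :: s) []

@[fun_prop]
theorem PF.unaryNats {y : γ → List Bool} (hy : PF y) : PF (fun c => unaryNats (y c)) := by
  refine hy.foldr (step := fun _ b s =>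
    bif b then (bif s.isEmpty then [] else (s.headD 0 + 1) :: s.tail) else 0 :: s)
    (PF.const _) (by fun_prop) ⟨2, fun c b s => ?_⟩
  cases b <;> cases s <;> simp <;> omega

/-- The list `l` contains the numbers below `n`, each of them once. -/
def isPermList (n : ℕ) (l : List ℕ) : Bool :=
  l.length == n && (List.range n).all fun i => l.any fun a => a == i

@[fun_prop]
theorem PF.isPermList {n : γ → ℕ} {l : γ → List ℕ} (hn : PF n) (hl : PF l) :
    PF (fun c => isPermList (n c) (l c)) := by
  refine PF.and (by fun_prop) (PF.all (f := fun c i => (l c).any fun a => a == i) (by fun_prop) ?_)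
  refine PF.any (f := fun (x : γ × ℕ) a => a == x.2) ?_ ?_ <;> fun_prop

/-- The permissible sequence that a binary string stands for; the Boolean value says whether there
is one. -/
def sequenceOf (I : RawInstance) (y : List Bool) : Bool × List ℕ :=
  bif I.2.2.1.1 then (isPermList I.2.2.2.2.length (unaryNats y), unaryNats y)
  else (Nat.ble (y.length + 1) I.2.2.1.2.length, I.2.2.1.2.getD y.length [])

@[fun_prop]
theorem PF.sequenceOf {I : γ → RawInstance} {y : γ → List Bool} (hI : PF I) (hy : PF y) :
    PF (fun c => sequenceOf (I c) (y c)) := by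
  unfold BFDS.sequenceOf
  fun_prop

/-- The test for `s + 1` time steps from `c`, where the sequences and the next configurations of the
first `s` time steps are given by a list of binary strings. -/
def checkGame (q : ℕ) : ℕ → RawInstance → List Bool → List (List Bool) → Bool
  | 0, I, c, _ => lastStep q I c
  | s + 1, I, c, ys =>
      bif (sequenceOf I (ys.headD [])).1 then
        ((ys.tail.headD []).length == I.2.2.2.2.length) &&
          (canStep I (sequenceOf I (ys.headD [])).2 c (ys.tail.headD []) &&
            checkGame q s I (ys.tail.headD []) ys.tail.tail)
      else true

@[fun_prop]
theorem PF.checkGame {I : γ → RawInstance} {x : γ → List Bool} {ys : γ → List (List Bool)}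
    (q s : ℕ) (hI : PF I) (hx : PF x) (hy : PF ys) :
    PF (fun c => checkGame q s (I c) (x c) (ys c)) := by
  have h : ∀ s, PF (fun a : RawInstance × List Bool × List (List Bool) =>
      BFDS.checkGame q s a.1 a.2.1 a.2.2) := by
    intro s
    induction s with
    | zero => simp only [BFDS.checkGame]; fun_prop
    | succ s ih =>
      simp only [BFDS.checkGame]
      have := ih.comp (f := fun a : RawInstance × List Bool × List (List Bool) =>
        (a.1, a.2.2.tail.headD [], a.2.2.tail.tail)) (by fun_prop)
      fun_prop
  exact (h s).comp (f := fun a => (I a, x a, ys a)) (by fun_prop)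

/-- The decision procedure. -/
noncomputable def decideTuple (q s : ℕ) (w : List Sym) : Bool :=
  checkGame q s (readInstance (splitTuple w).1) (readInstance (splitTuple w).1).2.2.2.1
    (splitTuple w).2.1

theorem PF.decideTuple (q s : ℕ) : PF (decideTuple q s) := by
  unfold BFDS.decideTuple
  fun_prop

end procedure

/-! ### Decoding an instance -/

theorem splitTuple_encTuple (x : List Letter) (ys : List (List Bool)) :
    splitTuple (encTuple (x, ys)) = (x, ys, []) := by
  have h₁ : ∀ (y : List Bool) s, (y.map fun b => (some (Sum.inr b) : Sym)).foldr splitStep s =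
      (s.1, s.2.1, y ++ s.2.2) := by
    intro y s
    induction y with
    | nil => rfl
    | cons b y ih => rw [List.map_cons, List.foldr_cons, ih]; rfl
  have h₂ : (ys.flatMap fun y => (none :: y.map fun b => some (Sum.inr b) : List Sym)).foldr
      splitStep ([], [], []) = ([], ys, []) := by
    induction ys with
    | nil => rfl
    | cons y ys ih =>
      rw [List.flatMap_cons, List.foldr_append, ih, List.foldr_cons, h₁]
      simp [splitStep]
  unfold splitTuple encTuple
  rw [List.foldr_append, h₂]
  induction x with
  | nil => rfl
  | cons a x ih => rw [List.map_cons, List.foldr_cons, ih]; rfl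

theorem segments_append {sep : Letter} {s : List Letter} (hs : sep ∉ s) (l : List Letter) :
    segments sep (s ++ sep :: l) = (s, (segments sep l).1 :: (segments sep l).2) := by
  induction s with
  | nil =>
    have : sep.is sep = true := Letter.is_iff.2 rfl
    simp [segments, this]
  | cons a s ih =>
    have h : a.is sep = false := by
      rw [Bool.eq_false_iff, Ne, Letter.is_iff]
      rintro rfl
      simp at hs
    have ih := ih fun h => hs (List.mem_cons_of_mem _ h)
    simp only [segments] at ih ⊢
    rw [List.cons_append, List.foldr_cons, ih, h]
    rfl

theorem segments_of_notMem {sep : Letter} {s : List Letter} (hs : sep ∉ s) :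
    segments sep s = (s, []) := by
  induction s with
  | nil => rfl
  | cons a s ih =>
    have h : a.is sep = false := by
      rw [Bool.eq_false_iff, Ne, Letter.is_iff]
      rintro rfl
      simp at hs
    have ih := ih fun h => hs (List.mem_cons_of_mem _ h)
    simp only [segments] at ih ⊢
    rw [List.foldr_cons, ih, h]
    rfl

theorem segments_flatMap {sep : Letter} {S : List (List Letter)} (hS : ∀ s ∈ S, sep ∉ s)
    (l : List Letter) :
    (segments sep ((S.flatMap fun s => s ++ [sep]) ++ l)).1 ::
        (segments sep ((S.flatMap fun s => s ++ [sep]) ++ l)).2 =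
      S ++ (segments sep l).1 :: (segments sep l).2 := by
  induction S with
  | nil => rfl
  | cons s S ih =>
    have h := segments_append (hS s (by simp)) ((S.flatMap fun s => s ++ [sep]) ++ l)
    rw [List.flatMap_cons, List.append_assoc, List.append_assoc, List.singleton_append, h,
      ih fun s hs => hS s (by simp [hs])]
    rfl

theorem terms_flatMap {sep : Letter} {S : List (List Letter)} (hS : ∀ s ∈ S, sep ∉ s) :
    terms sep (S.flatMap fun s => s ++ [sep]) = S := by
  have := segments_flatMap hS []
  rw [List.append_nil] at this
  rw [terms, this]
  simp [segments]

/-- Cutting off early does no harm: doubling a value that has reached `N` leaves it at least `N`. -/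
theorem readNat_bits (N m : ℕ) : readNat N (m.bits.map .bit) = min N m := by
  have h : ∀ b, (Letter.bit b).is (.bit true) = b := by
    intro b
    rw [Bool.eq_iff_iff, Letter.is_iff]
    simp
  induction m using Nat.binaryRec' with
  | zero => simp [readNat]
  | bit b m hb ih =>
    rw [Nat.bits_append_bit _ _ hb]
    simp only [readNat, List.map_cons, List.foldr_cons, h] at ih ⊢
    rw [ih]
    cases b <;> simp [Nat.bit] <;> omega

theorem readNats_flatMap {N : ℕ} {l : List ℕ} (hl : ∀ m ∈ l, m ≤ N) :
    readNats N (l.flatMap encNat) = l := by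
  have h : l.flatMap encNat =
      (l.map fun m => m.bits.map Letter.bit).flatMap fun s => s ++ [.comma] := by
    rw [List.flatMap_map]
    rfl
  rw [readNats, h, terms_flatMap (by simp), List.map_map]
  conv_rhs => rw [← List.map_id l]
  exact List.map_congr_left fun m hm => by
    simp only [Function.comp_apply, readNat_bits, id]
    exact min_eq_right (hl m hm)

/-- The type and the arguments of a gate. -/
def Gate.raw {n : ℕ} : Gate n → RawGate
  | .input i => (.inp, [i.val])
  | .not a => (.not, [a])
  | .and l => (.and, l)
  | .or l => (.or, l)

theorem Gate.enc_eq {n : ℕ} (g : Gate n) :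
    g.enc = (g.raw.1 :: g.raw.2.flatMap encNat) ++ [.semicolon] := by
  cases g <;> simp [Gate.enc, Gate.raw]

theorem Gate.raw_ne {n : ℕ} (g : Gate n) : g.raw.1 ≠ .semicolon ∧ g.raw.1 ≠ .close := by
  cases g <;> simp [Gate.raw]

theorem semicolon_notMem_nats (l : List ℕ) : Letter.semicolon ∉ l.flatMap encNat := by
  simp [encNat]

theorem close_notMem_nats (l : List ℕ) : Letter.close ∉ l.flatMap encNat := by
  simp [encNat]

/-- The gates of a circuit. -/
def Circuit.raw {n : ℕ} (C : Circuit n) : List RawGate := C.gates.map Gate.raw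

theorem close_notMem_gates {n : ℕ} (l : List (Gate n)) : Letter.close ∉ l.flatMap Gate.enc := by
  rw [List.mem_flatMap]
  rintro ⟨g, -, hg⟩
  rw [Gate.enc_eq] at hg
  simp only [List.mem_append, List.mem_cons, List.not_mem_nil, or_false] at hg
  rcases hg with (hg | hg) | hg
  · exact g.raw_ne.2 hg.symm
  · exact close_notMem_nats _ hg
  · cases hg

theorem length_le_length_flatMap {α β : Type} (f : α → List β) (hf : ∀ a, 1 ≤ (f a).length)
    (l : List α) : l.length ≤ (l.flatMap f).length := by
  induction l with
  | nil => simp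
  | cons a l ih =>
    have := hf a
    rw [List.flatMap_cons, List.length_append, List.length_cons]
    omega

/-- The cut-off at `N` changes no number: input indices are below `n`, and by `Circuit.wf`
references to gates are below the position of the referring gate. -/
theorem readCircuit_enc {n N : ℕ} (C : Circuit n) (hn : n ≤ N) (hC : C.gates.length ≤ N) :
    readCircuit N (C.gates.flatMap Gate.enc) = C.raw := by
  have h : C.gates.flatMap Gate.enc =
      (C.gates.map fun g => g.raw.1 :: g.raw.2.flatMap encNat).flatMap
        fun s => s ++ [.semicolon] := by
    rw [List.flatMap_map]
    exact congrArg (fun f => C.gates.flatMap f) (funext Gate.enc_eq)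
  rw [readCircuit, h, terms_flatMap, List.map_map]
  · refine List.map_congr_left fun g hg => ?_
    obtain ⟨p, hp, rfl⟩ := List.getElem_of_mem hg
    refine Prod.ext rfl (readNats_flatMap fun m hm => ?_)
    have h := C.wf p hp m
    cases hg : C.gates[p] with
    | input i =>
      rw [hg] at hm
      simp [Gate.raw] at hm
      omega
    | not a =>
      rw [hg] at h hm
      have := h hm
      omega
    | and l =>
      rw [hg] at h hm
      have := h hm
      omega
    | or l =>
      rw [hg] at h hm
      have := h hm
      omega
  · simp only [List.mem_map, forall_exists_index, and_imp, forall_apply_eq_imp_iff₂, List.mem_cons,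
      not_or]
    exact fun g _ => ⟨g.raw_ne.1.symm, semicolon_notMem_nats _⟩

/-- The sequence of the values of a permutation. -/
def permList {n : ℕ} (π : Equiv.Perm (Fin n)) : List ℕ := (List.ofFn π).map Fin.val

/-- A schedule, as a mark for the arbitrary schedule and the list of permissible sequences. -/
def Schedule.raw {n : ℕ} : Schedule n → Bool × List (List ℕ)
  | .list l _ => (false, l.map permList)
  | .arbitrary => (true, [])

/-- The encoding of a schedule up to its last letter. -/
def Schedule.body {n : ℕ} : Schedule n → List Letter
  | .list l _ => l.flatMap encPerm
  | .arbitrary => [.all]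

theorem Schedule.enc_eq {n : ℕ} (s : Schedule n) : s.enc = s.body ++ [.close] := by
  cases s <;> rfl

theorem encPerm_eq {n : ℕ} (π : Equiv.Perm (Fin n)) :
    encPerm π = (permList π).flatMap encNat ++ [.semicolon] := by
  rw [permList, List.flatMap_map]
  simp [encPerm, List.flatMap_assoc]

theorem Schedule.close_notMem_body {n : ℕ} (s : Schedule n) : Letter.close ∉ s.body := by
  cases s with
  | arbitrary => simp [Schedule.body]
  | list l hl =>
    simp only [Schedule.body, List.mem_flatMap, not_exists, not_and]
    intro π _ h
    rw [encPerm_eq, List.mem_append] at h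
    rcases h with h | h
    · exact close_notMem_nats _ h
    · simp at h

/-- The two kinds of schedule are told apart by the letter `.all`, which never occurs in a list of
permutations; without a semicolon, the arbitrary schedule contributes no sequences. -/
theorem readSchedule_body {n N : ℕ} (s : Schedule n) (hN : n ≤ N) :
    readSchedule N s.body = s.raw := by
  have hx : ∀ a b : Letter, a ≠ b → a.is b = false := fun a b h => by
    rw [Bool.eq_false_iff, Ne, Letter.is_iff]
    exact h
  cases s with
  | arbitrary =>
    have h₁ : Letter.all.is .all = true := Letter.is_iff.2 rfl
    have h₂ : segments .semicolon [Letter.all] = ([Letter.all], []) :=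
      segments_of_notMem (by simp)
    simp [Schedule.body, readSchedule, Schedule.raw, h₁, terms, h₂]
  | list l hl =>
    have h : l.flatMap encPerm = (l.map fun π => (permList π).flatMap encNat).flatMap
        fun s => s ++ [.semicolon] := by
      rw [List.flatMap_map]
      exact congrArg (fun f => l.flatMap f) (funext encPerm_eq)
    refine Prod.ext ?_ ?_
    · simp only [Schedule.body, readSchedule, Schedule.raw]
      refine hx _ _ fun h' => ?_
      have hm : Letter.all ∈ l.flatMap encPerm := by
        cases hl : l.flatMap encPerm with
        | nil => rw [hl] at h'; cases h'
        | cons a t => rw [hl] at h'; simp at h'; simp [h']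
      rw [List.mem_flatMap] at hm
      obtain ⟨π, -, hm⟩ := hm
      rw [encPerm_eq] at hm
      simp [encNat] at hm
    · simp only [Schedule.body, readSchedule, Schedule.raw]
      rw [h, terms_flatMap, List.map_map]
      · refine List.map_congr_left fun π _ => readNats_flatMap ?_
        simp only [permList, List.mem_map, forall_exists_index, and_imp, forall_apply_eq_imp_iff₂]
        intro i _
        omega
      · simp only [List.mem_map, forall_exists_index, and_imp, forall_apply_eq_imp_iff₂]
        exact fun π _ => semicolon_notMem_nats _

/-- The data that the decision procedure extracts from the encoding of an instance. -/
def Instance.raw (I : Instance) : RawInstance :=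
  (I.k, (List.finRange I.n).flatMap (fun i => (List.finRange I.k).map fun j => (I.circ i j).raw),
    I.sched.raw, List.ofFn I.c, List.ofFn I.d)

theorem readConfig_map (l : List Bool) : readConfig (l.map .bit) = l := by
  rw [readConfig, List.map_map]
  conv_rhs => rw [← List.map_id l]
  refine List.map_congr_left fun b _ => ?_
  rw [Function.comp_apply, Bool.eq_iff_iff, Letter.is_iff]
  simp

theorem Instance.n_le_length_enc (I : Instance) : I.n ≤ I.enc.length := by
  simp only [Instance.enc, encUnary, List.length_append, List.length_replicate]
  omega

theorem length_le_flatMap {α β : Type} (f : α → List β) {a : α} {l : List α} (ha : a ∈ l) :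
    (f a).length ≤ (l.flatMap f).length := by
  rw [List.length_flatMap]
  exact List.le_sum_of_mem (List.mem_map_of_mem (f := fun a => (f a).length) ha)

theorem Instance.length_gates_le (I : Instance) (i : Fin I.n) (j : Fin I.k) :
    (I.circ i j).gates.length ≤ I.enc.length := by
  have h₁ := length_le_length_flatMap Gate.enc (fun g => by simp [Gate.enc_eq]) (I.circ i j).gates
  have h₂ : (I.circ i j).enc.length ≤ ((List.finRange I.n).flatMap fun i =>
      (List.finRange I.k).flatMap fun j => (I.circ i j).enc).length := by
    exact (length_le_flatMap (fun j => (I.circ i j).enc) (List.mem_finRange j)).trans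
      (length_le_flatMap (fun i => (List.finRange I.k).flatMap fun j => (I.circ i j).enc)
        (List.mem_finRange i))
  simp only [Instance.enc, List.length_append, Circuit.enc] at h₂ ⊢
  omega

/-- After the two unary numbers, the letter `.close` occurs exactly at the end of each circuit and
of the schedule. Splitting there leaves the circuits, the schedule and one last piece with both
configurations; the last two pieces are taken from the reversed list. -/
theorem readInstance_enc (I : Instance) : readInstance I.enc = I.raw := by
  set B : List (List Letter) := (List.finRange I.n).flatMap fun i =>
    (List.finRange I.k).map fun j => (I.circ i j).gates.flatMap Gate.enc with hB
  set R := (List.finRange I.n).flatMap (fun i => (List.finRange I.k).flatMap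
    fun j => (I.circ i j).enc) ++ I.sched.enc ++ encConfig I.c ++ encConfig I.d with hR
  have hR' : R = ((B ++ [I.sched.body]).flatMap fun s => s ++ [.close]) ++
      (encConfig I.c ++ encConfig I.d) := by
    rw [hR, hB, List.flatMap_append, List.flatMap_assoc, I.sched.enc_eq]
    simp [List.flatMap_map, Circuit.enc]
  have hE : I.enc = List.replicate I.n (Letter.bit true) ++ .comma ::
      (List.replicate I.k (Letter.bit true) ++ .comma :: R) := by
    simp [Instance.enc, encUnary, hR]
  have hs₁ : segments .comma I.enc = (List.replicate I.n (Letter.bit true),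
      List.replicate I.k (Letter.bit true) :: (segments .comma R).1 :: (segments .comma R).2) := by
    rw [hE, segments_append (by simp [List.mem_replicate]),
      segments_append (by simp [List.mem_replicate])]
  -- The summand 2 counts the commas after the two numbers.
  have hs₂ : readSizes I.enc = (I.n + I.k + 2, I.k) := by
    simp [readSizes, hs₁]
  have hd : I.enc.drop (I.n + I.k + 2) = R := by
    have : I.enc = (List.replicate I.n (Letter.bit true) ++ [.comma] ++
      (List.replicate I.k (Letter.bit true) ++ [.comma])) ++ R := by simp [hE]
    rw [this, List.drop_left']
    simp
    omega
  have hc : Letter.close ∉ encConfig I.c ++ encConfig I.d := by simp [encConfig]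
  have hs₃ : (segments .close R).1 :: (segments .close R).2 =
      B ++ [I.sched.body] ++ [encConfig I.c ++ encConfig I.d] := by
    rw [hR', segments_flatMap, segments_of_notMem hc]
    intro s hs
    rw [hB, List.mem_append, List.mem_flatMap] at hs
    rcases hs with ⟨i, -, hs⟩ | hs
    · obtain ⟨j, -, rfl⟩ := List.mem_map.1 hs
      exact close_notMem_gates _
    · rw [List.mem_singleton.1 hs]
      exact I.sched.close_notMem_body
  have hs₄ : segments .semicolon (encConfig I.c ++ encConfig I.d) =
      ((List.ofFn I.c).map .bit, [(List.ofFn I.d).map .bit, []]) := by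
    have h : encConfig I.c ++ encConfig I.d = (List.ofFn I.c).map Letter.bit ++ .semicolon ::
      ((List.ofFn I.d).map Letter.bit ++ [.semicolon]) := by simp [encConfig]
    rw [h, segments_append (by simp), segments_append (by simp)]
    rfl
  rw [readInstance, hs₂, hd, hs₃]
  simp only [List.reverse_append, List.reverse_singleton, readParts,
    List.tail_cons, List.headD_cons, List.reverse_reverse, hs₄, readConfig_map, Instance.raw,
    List.cons_append, List.nil_append, readSchedule_body I.sched I.n_le_length_enc]
  congr 2
  rw [hB, List.map_flatMap]
  refine congrArg (fun f => (List.finRange I.n).flatMap f) (funext fun i => ?_)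
  rw [List.map_map]
  exact List.map_congr_left fun j _ =>
    readCircuit_enc _ I.n_le_length_enc (I.length_gates_le i j)

/-! ### One time step -/

section step

variable {n k : ℕ}

/-- The updates of the nodes in `l`, one after the other from `x`, can give them the values that
they have in `d`. -/
def Chain (F : DTBFDS n k) (d : Config n) : List (Fin n) → Config n → Prop
  | [], _ => True
  | i :: l, x => (∃ j, F i j x = d i) ∧ Chain F d l (Function.update x i (d i))

/-- Since no node occurs twice in `l`, the value a node gets at its update is final and must be the
one in `d`. Then the configurations along the way do not depend on `J`, and the functions can be
selected node by node. -/
theorem exists_foldl_iff (F : DTBFDS n k) (hk : 1 ≤ k) (d : Config n) {l : List (Fin n)}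
    (hl : l.Nodup) (c : Config n) :
    (∃ J : Fin n → Fin k, l.foldl (fun x i => Function.update x i (F i (J i) x)) c = d) ↔
      (∀ i ∉ l, c i = d i) ∧ Chain F d l c := by
  induction l generalizing c with
  | nil =>
    simp only [List.foldl_nil, List.not_mem_nil, not_false_eq_true, forall_const, Chain, and_true]
    -- Nothing is updated here; `hk` only guarantees that there is some selection.
    exact ⟨fun ⟨_, h⟩ i => congrFun h i, fun h => ⟨fun _ => ⟨0, hk⟩, funext h⟩⟩
  | cons i l ih =>
    rw [List.nodup_cons] at hl
    simp only [List.foldl_cons, Chain]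
    constructor
    · rintro ⟨J, hJ⟩
      obtain ⟨h₁, h₂⟩ := (ih hl.2 _).1 ⟨J, hJ⟩
      have h₃ := h₁ i hl.1
      rw [Function.update_self] at h₃
      rw [h₃] at h₂
      refine ⟨fun m hm => ?_, ⟨J i, h₃⟩, h₂⟩
      rw [List.mem_cons, not_or] at hm
      simpa [Function.update_of_ne hm.1] using h₁ m hm.2
    · rintro ⟨h₁, ⟨j, hj⟩, h₂⟩
      obtain ⟨J, hJ⟩ := (ih hl.2 (Function.update c i (d i))).2 ⟨fun m hm => by
        rcases eq_or_ne m i with rfl | hmi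
        · simp
        · rw [Function.update_of_ne hmi]
          exact h₁ m (by simp [hmi, hm]), h₂⟩
      -- Node `i` does not occur in `l`, so changing its choice does not affect the later updates.
      refine ⟨Function.update J i j, ?_⟩
      rw [Function.update_self, hj]
      refine Eq.trans ?_ hJ
      refine List.foldl_ext _ _ _ fun x m hm => ?_
      rw [Function.update_of_ne]
      rintro rfl
      exact hl.1 hm

theorem run_iff_chain (F : DTBFDS n k) (hk : 1 ≤ k) (π : Equiv.Perm (Fin n)) (c d : Config n) :
    (∃ J, F.run π J c = d) ↔ Chain F d (List.ofFn π) c := by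
  rw [← and_iff_right (a := ∀ i ∉ List.ofFn π, c i = d i) (b := Chain F d (List.ofFn π) c)]
  · exact exists_foldl_iff F hk d (List.nodup_ofFn.2 π.injective) c
  · intro i hi
    exact absurd ((List.mem_ofFn' _ _).2 (π.surjective i)) hi

theorem robustlyTakes_succ_iff (F : DTBFDS n k) (hk : 1 ≤ k) (s : Schedule n) (t : ℕ)
    (c d : Config n) : RobustlyTakes F s (t + 1) c d ↔
      ∀ π, s.Permits π → ∃ c', Chain F c' (List.ofFn π) c ∧ RobustlyTakes F s t c' d := by
  refine forall_congr' fun π => imp_congr_right fun _ => ?_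
  constructor
  · rintro ⟨J, c', hJ, h⟩
    exact ⟨c', (run_iff_chain F hk π c c').1 ⟨J, hJ⟩, h⟩
  · rintro ⟨c', hc, h⟩
    obtain ⟨J, hJ⟩ := (run_iff_chain F hk π c c').2 hc
    exact ⟨J, c', hJ, h⟩

/-! ### The last time step under the arbitrary schedule -/

theorem chain_append (F : DTBFDS n k) (d : Config n) (l l' : List (Fin n)) (x : Config n) :
    Chain F d (l ++ l') x ↔
      Chain F d l x ∧ Chain F d l' (l.foldl (fun x i => Function.update x i (d i)) x) := by
  induction l generalizing x with
  | nil => simp [Chain]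
  | cons i l ih => simp [Chain, ih, and_assoc]

theorem foldl_update_apply (d x : Config n) (l : List (Fin n)) (m : Fin n) :
    l.foldl (fun x i => Function.update x i (d i)) x m = if m ∈ l then d m else x m := by
  induction l generalizing x with
  | nil => simp
  | cons i l ih =>
    rw [List.foldl_cons, ih]
    rcases eq_or_ne m i with rfl | h
    · simp
    · simp [h]

/-- The configurations that are possible immediately before the update of node `i` in a step from
`c` to `d`. -/
def Box (c d : Config n) (i : Fin n) (x : Config n) : Prop :=
  x i = c i ∧ ∀ m, x m = c m ∨ x m = d m

theorem exists_perm_of_nodup {l : List (Fin n)} (hl : l.Nodup) (hm : ∀ i, i ∈ l) :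
    ∃ π : Equiv.Perm (Fin n), List.ofFn π = l := by
  have hlen : l.length = n := by
    have h := List.toFinset_card_of_nodup hl
    have h' : l.toFinset = Finset.univ := by ext i; simp [hm]
    rw [h', Finset.card_univ, Fintype.card_fin] at h
    exact h.symm
  have hinj : Function.Injective fun i : Fin n => l.get (i.cast hlen.symm) := fun a b h => by
    have := (List.nodup_iff_injective_get.1 hl) h
    simpa [Fin.ext_iff] using this
  refine ⟨Equiv.ofBijective _ (Finite.injective_iff_bijective.1 hinj), ?_⟩
  refine List.ext_getElem (by simp [hlen]) fun m h₁ h₂ => by simp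

/-- Just before the update of `i`, the nodes that precede it have their entries of `d` and all
others those of `c`. Any set of other nodes is the set of predecessors of `i` in some order, so all
points of the box occur. -/
theorem forall_chain_iff (F : DTBFDS n k) (c d : Config n) :
    (∀ π : Equiv.Perm (Fin n), Chain F d (List.ofFn π) c) ↔
      ∀ i x, Box c d i x → ∃ j, F i j x = d i := by
  classical
  constructor
  · rintro h i x ⟨hi, hx⟩
    -- In the order that produces `x`, the other nodes at which `x` agrees with `d` precede `i`, and
    -- the remaining ones follow.
    set l₁ := (List.finRange n).filter fun m => decide (m ≠ i ∧ x m = d m) with hl₁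
    set l₂ := (List.finRange n).filter fun m => decide (m ≠ i ∧ x m ≠ d m) with hl₂
    obtain ⟨π, hπ⟩ := exists_perm_of_nodup (l := l₁ ++ i :: l₂) (by
      rw [List.nodup_append, List.nodup_cons]
      refine ⟨(List.nodup_finRange n).filter _, ⟨by simp [hl₂],
        (List.nodup_finRange n).filter _⟩, ?_⟩
      rintro a ha b hb rfl
      simp [hl₁] at ha
      simp [hl₂] at hb
      tauto) (by
      intro m
      simp [hl₁, hl₂]
      tauto)
    have hc := h π
    rw [hπ, chain_append] at hc
    obtain ⟨j, hj⟩ := hc.2.1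
    refine ⟨j, ?_⟩
    convert hj using 2
    funext m
    rw [foldl_update_apply]
    split_ifs with hm
    · simp [hl₁] at hm
      exact hm.2
    · simp [hl₁] at hm
      rcases eq_or_ne m i with rfl | hmi
      · exact hi
      · exact (hx m).resolve_right (hm hmi)
  · intro h π
    -- Generalised to the rest `l` of the order: the nodes still to be updated have their entries of
    -- `c`, the others may have those of `c` or `d`.
    have key : ∀ l : List (Fin n), l.Nodup → ∀ x, (∀ m, x m = c m ∨ x m = d m) →
        (∀ i ∈ l, x i = c i) → Chain F d l x := by
      intro l
      induction l with
      | nil => exact fun _ _ _ _ => trivial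
      | cons i l ih =>
        intro hl x hx hxl
        rw [List.nodup_cons] at hl
        refine ⟨h i x ⟨hxl i (by simp), hx⟩, ih hl.2 _ (fun m => ?_) fun m hm => ?_⟩
        · rcases eq_or_ne m i with rfl | hmi
          · simp
          · simpa [hmi] using hx m
        · rw [Function.update_of_ne (by rintro rfl; exact hl.1 hm)]
          exact hxl m (by simp [hm])
    exact key _ (List.nodup_ofFn.2 π.injective) c (fun m => .inl rfl) fun _ _ => rfl

/-- Node `i` can get the value that it has in `d` at all configurations that arise from `x` by
setting `q` entries to those of `c` or `d`, but never the `i`-th one to that of `d`. -/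
def Always (F : DTBFDS n k) (c d : Config n) (i : Fin n) : ℕ → Config n → Prop
  | 0, x => ∃ j, F i j x = d i
  | q + 1, x => ∀ m, Always F c d i q (Function.update x m (c m)) ∧
      (m = i ∨ Always F c d i q (Function.update x m (d m)))

/-- The least or greatest configuration in a box. -/
def extreme (c d : Config n) (i m : Fin n) : Bool :=
  if m = i then c m else if d i then c m && d m else c m || d m

theorem box_extreme (c d : Config n) (i : Fin n) : Box c d i (extreme c d i) := by
  refine ⟨by simp [extreme], fun m => ?_⟩
  unfold extreme
  split_ifs <;> cases c m <;> cases d m <;> simp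

theorem always_of_forall {F : DTBFDS n k} {c d : Config n} {i : Fin n}
    (h : ∀ x, Box c d i x → ∃ j, F i j x = d i) (q : ℕ) {x : Config n} (hx : Box c d i x) :
    Always F c d i q x := by
  induction q generalizing x with
  | zero => exact h x hx
  | succ q ih =>
    refine fun m => ⟨ih ⟨?_, fun m' => ?_⟩, or_iff_not_imp_left.2 fun hm => ih ⟨?_, fun m' => ?_⟩⟩
    · rcases eq_or_ne i m with rfl | him
      · simp
      · simpa [him] using hx.1
    · rcases eq_or_ne m' m with rfl | him
      · simp
      · simpa [him] using hx.2 m'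
    · simpa [Ne.symm hm] using hx.1
    · rcases eq_or_ne m' m with rfl | him
      · simp
      · simpa [him] using hx.2 m'

/-- As `x` lies in the box, copying an entry of `x` is one of the changes that `Always` allows; at
`i` this entry is that of `c`. -/
theorem Always.exists_foldl {F : DTBFDS n k} {c d : Config n} {i : Fin n} {q : ℕ}
    {y x : Config n} (h : Always F c d i q y) (hx : Box c d i x) {T : List (Fin n)}
    (hT : T.length = q) :
    ∃ j, F i j (T.foldl (fun y m => Function.update y m (x m)) y) = d i := by
  induction T generalizing q y with
  | nil =>
    subst hT
    exact h
  | cons m T ih =>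
    subst hT
    refine ih ?_ rfl
    beta_reduce
    rcases eq_or_ne m i with rfl | hm
    · rw [hx.1]
      exact (h m).1
    · rcases hx.2 m with hxm | hxm
      · rw [hxm]
        exact (h m).1
      · rw [hxm]
        exact (h m).2.resolve_left hm

/-- Turn `y` into `x` one entry at a time: each change is either void or concerns an argument that
does not matter. -/
theorem eq_of_eq_on_dependsOn {f : Config n → Bool} {x y : Config n}
    (h : ∀ m, DependsOn f m → x m = y m) : f x = f y := by
  have hu : ∀ (z : Config n) m b b', ¬ DependsOn f m →
      f (Function.update z m b) = f (Function.update z m b') := by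
    intro z m b b' hm
    have : f (Function.update z m true) = f (Function.update z m false) := by
      by_contra hne
      exact hm ⟨z, hne⟩
    cases b <;> cases b' <;> simp [this]
  have key : ∀ S : Finset (Fin n), f (S.piecewise x y) = f y := by
    intro S
    induction S using Finset.induction_on with
    | empty => simp
    | insert m S hm ih =>
      rw [Finset.piecewise_insert, ← ih]
      by_cases hd : DependsOn f m
      · rw [h m hd]
        congr 1
        refine Function.update_eq_self_iff.2 ?_
        simp [hm]
      · rw [hu _ m _ (S.piecewise x y m) hd, Function.update_eq_self]
  simpa using key Finset.univ

theorem IsOr.mono {f : Config n → Bool} (h : IsOr f) {x y : Config n}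
    (hxy : ∀ m, x m = true → y m = true) (hx : f x = true) : f y = true := by
  obtain ⟨S, hS⟩ := h
  obtain ⟨i, hi, hxi⟩ := (hS x).1 hx
  exact (hS y).2 ⟨i, hi, hxy i hxi⟩

theorem IsAnd.mono {f : Config n → Bool} (h : IsAnd f) {x y : Config n}
    (hxy : ∀ m, x m = true → y m = true) (hx : f x = true) : f y = true := by
  obtain ⟨S, hS⟩ := h
  exact (hS y).2 fun i hi => hxy i ((hS x).1 hx i hi)

/-- The nontrivial direction transfers a good choice from a point `y` to `x`, where `y` is the
extreme point with the entries of `x` copied on the set `U` of all arguments relevant to functions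
of small fan-in at node `i`. Such functions cannot distinguish `x` and `y`, and for the others
monotonicity suffices. -/
theorem always_extreme_iff {F : DTBFDS n k} {K q : ℕ} (hk : k ≤ K)
    (hF : ∀ i j, HasFanIn q (F i j) ∨ IsOr (F i j) ∨ IsAnd (F i j)) (c d : Config n) (i : Fin n) :
    Always F c d i (K * q) (extreme c d i) ↔ ∀ x, Box c d i x → ∃ j, F i j x = d i := by
  classical
  refine ⟨fun h x hx => ?_, fun h => always_of_forall h _ (box_extreme c d i)⟩
  by_contra hne
  push Not at hne
  set U : Finset (Fin n) := Finset.univ.biUnion fun j : Fin k =>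
    if HasFanIn q (F i j) then Finset.univ.filter fun m => DependsOn (F i j) m else ∅ with hU
  have hcard : U.card ≤ K * q := by
    refine Finset.card_biUnion_le.trans ((Finset.sum_le_card_nsmul _ _ q fun j _ => ?_).trans ?_)
    · split_ifs with hj
      · rw [HasFanIn, Set.ncard_eq_toFinset_card'] at hj
        simpa using hj
      · simp
    · simpa using Nat.mul_le_mul_right q hk
  -- `Always` asks for exactly `K * q` changes; the list is padded with `i`, where `x` and the
  -- extreme point both have the entry of `c`.
  obtain ⟨j, hj⟩ := h.exists_foldl hx (T := U.toList ++ List.replicate (K * q - U.card) i)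
    (by simp; omega)
  set y := (U.toList ++ List.replicate (K * q - U.card) i).foldl
    (fun y m => Function.update y m (x m)) (extreme c d i) with hy
  have hyx : ∀ m, y m = x m ∨ y m = extreme c d i m := by
    intro m
    rw [hy, foldl_update_apply]
    split_ifs <;> simp
  have hyU : ∀ m ∈ U, y m = x m := by
    intro m hm
    rw [hy, foldl_update_apply, if_pos (by simp [hm])]
  -- Where `y` differs from `x` it has the extreme entry. So `y` lies below `x` if `d i` is true and
  -- above it otherwise, and a monotone function with value `d i` at `y` has it at `x` too.
  have hmono : ∀ {f : Config n → Bool},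
      (∀ {x y : Config n}, (∀ m, x m = true → y m = true) → f x = true → f y = true) →
      f y = d i → f x = d i := by
    intro f hf hfy
    have hyx : ∀ m, y m = x m ∨ (m ≠ i ∧ y m = if d i then c m && d m else c m || d m) := by
      intro m
      rcases hyx m with h | h
      · exact .inl h
      · rcases eq_or_ne m i with rfl | hm
        · exact .inl (by rw [h, hx.1]; simp [extreme])
        · exact .inr ⟨hm, by rw [h]; simp [extreme, hm]⟩
    cases hd : d i with
    | true =>
      refine hf (fun m hm => ?_) (hfy.trans hd)
      rcases hyx m with h | ⟨-, h⟩
      · rwa [← h]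
      · rw [h, hd] at hm
        simp at hm
        rcases hx.2 m with h' | h' <;> simp [h', hm]
    | false =>
      rw [Bool.eq_false_iff]
      intro hfx
      refine absurd (hfy.trans hd) (ne_of_eq_of_ne (hf (fun m hm => ?_) hfx) (by simp))
      rcases hyx m with h | ⟨-, h⟩
      · rwa [h]
      · rw [h, hd]
        rcases hx.2 m with h' | h' <;> simp [← h', hm]
  refine hne j ?_
  by_cases hq : HasFanIn q (F i j)
  · rw [← hj]
    refine (eq_of_eq_on_dependsOn fun m hm => hyU m ?_).symm
    rw [hU, Finset.mem_biUnion]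
    exact ⟨j, by simp, by simp [hq, hm]⟩
  · rcases (hF i j).resolve_left hq with h' | h'
    · exact hmono h'.mono hj
    · exact hmono h'.mono hj

end step

/-! ### Correctness of the decision procedure -/

section correct

variable {n k : ℕ}

theorem getD_ofFn (x : Config n) (i : Fin n) : (List.ofFn x).getD i false = x i := by
  simp [List.getD_eq_getElem?_getD]

theorem map_range_eq_ofFn {f : ℕ → Bool} {x : Config n} (h : ∀ i : Fin n, f i = x i) :
    (List.range n).map f = List.ofFn x := by
  refine List.ext_getElem (by simp) fun m h₁ h₂ => ?_
  simp only [List.length_ofFn] at h₂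
  simpa using h ⟨m, h₂⟩

theorem setAt_ofFn (x : Config n) (i : Fin n) (b : Bool) :
    setAt (List.ofFn x) i b = List.ofFn (Function.update x i b) := by
  rw [setAt, List.length_ofFn]
  refine map_range_eq_ofFn fun m => ?_
  rcases eq_or_ne m i with rfl | h
  · simp
  · have : ((m : ℕ) == i) = false := by simpa [Fin.val_inj] using h
    rw [this, cond_false, getD_ofFn, Function.update_of_ne h]

theorem extremePoint_ofFn (c d : Config n) (i : Fin n) :
    extremePoint (List.ofFn c) (List.ofFn d) i = List.ofFn (extreme c d i) := by
  rw [extremePoint, List.length_ofFn]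
  refine map_range_eq_ofFn fun m => ?_
  simp only [getD_ofFn, extreme]
  rcases eq_or_ne m i with rfl | h
  · simp
  · have : ((m : ℕ) == i) = false := by simpa [Fin.val_inj] using h
    rw [this, cond_false, if_neg h]
    cases d i <;> simp

theorem gateVal_raw (x : Config n) (v : List Bool) (g : Gate n) :
    gateVal (List.ofFn x) v g.raw = g.val x v := by
  cases g with
  | input i => exact getD_ofFn x i
  | not a => rfl
  | and l => rfl
  | or l => rfl

theorem circVal_raw (C : Circuit n) (x : Config n) :
    circVal C.raw (List.ofFn x) = C.eval x := by
  simp only [circVal, Circuit.eval, Circuit.raw, List.foldl_map, gateVal_raw]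

theorem getElem?_flatMap_mul_add {α β : Type} (f : α → List β) (l : List α)
    (hf : ∀ a, (f a).length = k) (i : ℕ) {j : ℕ} (hj : j < k) :
    (l.flatMap f)[i * k + j]? = l[i]?.bind fun a => (f a)[j]? := by
  induction l generalizing i with
  | nil => simp
  | cons a l ih =>
    rw [List.flatMap_cons]
    cases i with
    | zero =>
      rw [List.getElem?_append_left (by rw [hf]; omega)]
      simp
    | succ i =>
      rw [List.getElem?_append_right (by rw [hf]; nlinarith), hf,
        show (i + 1) * k + j - k = i * k + j by rw [Nat.succ_mul]; omega, ih]
      simp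

theorem canBecome_raw (I : Instance) (x : Config I.n) (i : Fin I.n) (b : Bool) :
    canBecome I.raw (List.ofFn x) i b = true ↔ ∃ j, I.system i j x = b := by
  have h : ∀ j : Fin I.k, I.raw.2.1.getD (i * I.k + j) [] = (I.circ i j).raw := by
    intro j
    rw [List.getD_eq_getElem?_getD, Instance.raw, getElem?_flatMap_mul_add _ _ (by simp) _ j.2]
    simp
  have h' : ∀ j : Fin I.k, circVal (I.raw.2.1.getD (i * I.k + j) []) (List.ofFn x) =
      I.system i j x := fun j => by
    rw [h, circVal_raw]
    rfl
  simp only [canBecome, List.any_eq_true, List.mem_range, beq_iff_eq]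
  exact ⟨fun ⟨j, hj, e⟩ => ⟨⟨j, hj⟩, (h' ⟨j, hj⟩).symm.trans e⟩,
    fun ⟨j, e⟩ => ⟨j, j.2, (h' j).trans e⟩⟩

theorem canStep_raw (I : Instance) (l : List (Fin I.n)) (c d : Config I.n) :
    canStep I.raw (l.map Fin.val) (List.ofFn c) (List.ofFn d) = true ↔
      Chain I.system d l c := by
  have h : ∀ (l : List (Fin I.n)) (c : Config I.n) (b : Bool),
      ((l.map Fin.val).foldl (stepTo I.raw (List.ofFn d)) (List.ofFn c, b)).2 = true ↔
        b = true ∧ Chain I.system d l c := by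
    intro l
    induction l with
    | nil => simp [Chain]
    | cons i l ih =>
      intro c b
      rw [List.map_cons, List.foldl_cons, stepTo, getD_ofFn, setAt_ofFn, ih, Chain,
        Bool.and_eq_true, canBecome_raw, and_assoc]
  exact (h l c true).trans (and_iff_right rfl)

theorem canAlways_raw (I : Instance) (c d : Config I.n) (i : Fin I.n) (q : ℕ) (x : Config I.n) :
    canAlways I.raw (List.ofFn c) (List.ofFn d) i q (List.ofFn x) = true ↔
      Always I.system c d i q x := by
  induction q generalizing x with
  | zero => rw [canAlways, getD_ofFn, canBecome_raw, Always]
  | succ q ih =>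
    simp only [canAlways, Always, List.all_eq_true, List.mem_range, List.length_ofFn]
    have key : ∀ m : Fin I.n,
        (canAlways I.raw (List.ofFn c) (List.ofFn d) i q
            (setAt (List.ofFn x) m ((List.ofFn c).getD m false)) &&
          ((m : ℕ) == i || canAlways I.raw (List.ofFn c) (List.ofFn d) i q
            (setAt (List.ofFn x) m ((List.ofFn d).getD m false)))) = true ↔
        Always I.system c d i q (Function.update x m (c m)) ∧
          (m = i ∨ Always I.system c d i q (Function.update x m (d m))) := fun m => by
      rw [getD_ofFn, getD_ofFn, setAt_ofFn, setAt_ofFn, Bool.and_eq_true, Bool.or_eq_true, ih,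
        ih, beq_iff_eq, Fin.val_inj]
    exact ⟨fun h m => (key m).1 (h m m.2), fun h m hm => (key ⟨m, hm⟩).2 (h ⟨m, hm⟩)⟩

/-- This is where the restrictions on the system enter, and only for the arbitrary schedule. -/
theorem lastStep_raw {I : Instance} {K q : ℕ} (hI : I.Simple K q) (c : Config I.n) :
    lastStep (K * q) I.raw (List.ofFn c) = true ↔ RobustlyTakes I.system I.sched 1 c I.d := by
  have hR : RobustlyTakes I.system I.sched 1 c I.d ↔
      ∀ π, I.sched.Permits π → Chain I.system I.d (List.ofFn π) c := by
    rw [robustlyTakes_succ_iff _ I.k_pos]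
    refine forall_congr' fun π => imp_congr_right fun _ => ?_
    simp [RobustlyTakes]
  rw [hR]
  cases hs : I.sched with
  | list l hl =>
    simp only [lastStep, Instance.raw, hs, Schedule.raw, cond_false, List.all_map,
      List.all_eq_true, Schedule.Permits, Function.comp_apply, permList]
    exact forall_congr' fun π => imp_congr_right fun _ => canStep_raw I (List.ofFn π) c I.d
  | arbitrary =>
    have h₁ : (∀ π, (Schedule.arbitrary : Schedule I.n).Permits π →
        Chain I.system I.d (List.ofFn π) c) ↔
        ∀ i : Fin I.n, Always I.system c I.d i (K * q) (extreme c I.d i) := by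
      simp only [Schedule.Permits, true_imp_iff, forall_chain_iff, always_extreme_iff hI.1 hI.2]
    have h₂ : lastStep (K * q) I.raw (List.ofFn c) =
        (List.range I.n).all fun i => canAlways I.raw (List.ofFn c) (List.ofFn I.d) i (K * q)
          (extremePoint (List.ofFn c) (List.ofFn I.d) i) := by
      simp only [lastStep, Instance.raw, hs, Schedule.raw, cond_true, List.length_ofFn]
    rw [h₁, h₂]
    simp only [List.all_eq_true, List.mem_range]
    constructor
    · intro h i
      rw [← canAlways_raw, ← extremePoint_ofFn]
      exact h i i.2
    · intro h i hi
      have := h ⟨i, hi⟩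
      rw [← canAlways_raw, ← extremePoint_ofFn] at this
      exact this

/-! ### Binary strings as names of permissible sequences -/

theorem unaryNats_encode (l : List ℕ) :
    unaryNats (l.flatMap fun m => List.replicate m true ++ [false]) = l := by
  have h : ∀ (m a : ℕ) (s : List ℕ), (List.replicate m true).foldr (fun b s =>
      bif b then (bif s.isEmpty then [] else (s.headD 0 + 1) :: s.tail) else 0 :: s) (a :: s) =
      (a + m) :: s := by
    intro m a s
    induction m with
    | zero => rfl
    | succ m ih => rw [List.replicate_succ, List.foldr_cons, ih]; rfl
  induction l with
  | nil => rfl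
  | cons m l ih =>
    simp only [unaryNats] at ih ⊢
    rw [List.flatMap_cons, List.foldr_append, ih, List.foldr_append]
    simpa using h m 0 l

theorem isPermList_iff (l : List ℕ) :
    isPermList n l = true ↔ ∃ π : Equiv.Perm (Fin n), permList π = l := by
  simp only [isPermList, Bool.and_eq_true, beq_iff_eq, List.all_eq_true, List.mem_range,
    List.any_eq_true, exists_eq_right]
  constructor
  · rintro ⟨hn, h⟩
    -- A list of length `n` that contains all `n` numbers has no room for repetitions or other
    -- entries.
    have hperm : (List.range n).Perm l :=
      (List.subperm_of_subset List.nodup_range fun i hi =>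
        h i (List.mem_range.1 hi)).perm_of_length_le (by simp [hn])
    have hlt : ∀ i ∈ l, i < n := fun i hi => List.mem_range.1 (hperm.mem_iff.2 hi)
    obtain ⟨l', hl⟩ : ∃ l' : List (Fin n), l'.map Fin.val = l :=
      ⟨l.attach.map fun i => ⟨i.1, hlt i.1 i.2⟩, by
        rw [List.map_map]
        exact List.attach_map_subtype_val l⟩
    obtain ⟨π, hπ⟩ := exists_perm_of_nodup (l := l')
      (List.Nodup.of_map Fin.val (hl ▸ hperm.nodup_iff.1 List.nodup_range))
      (fun i => by
        have hi := h i i.2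
        rw [← hl, List.mem_map] at hi
        obtain ⟨j, hj, e⟩ := hi
        rwa [← Fin.ext e])
    exact ⟨π, by rw [permList, hπ, hl]⟩
  · rintro ⟨π, rfl⟩
    refine ⟨by simp [permList], fun i hi => ?_⟩
    rw [permList, List.mem_map]
    exact ⟨⟨i, hi⟩, (List.mem_ofFn' _ _).2 (π.surjective _), rfl⟩

theorem exists_of_sequenceOf {I : Instance} {y : List Bool}
    (h : (sequenceOf I.raw y).1 = true) :
    ∃ π, I.sched.Permits π ∧ (sequenceOf I.raw y).2 = permList π := by
  cases hs : I.sched with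
  | list l hl =>
    simp only [sequenceOf, Instance.raw, hs, Schedule.raw, cond_false, Nat.ble_eq,
      List.length_map] at h ⊢
    exact ⟨l[y.length], List.getElem_mem _, by
      simp [List.getD_eq_getElem?_getD, List.getElem?_eq_getElem (show y.length < l.length from h)]⟩
  | arbitrary =>
    simp only [sequenceOf, Instance.raw, hs, Schedule.raw, cond_true, List.length_ofFn,
      isPermList_iff] at h ⊢
    obtain ⟨π, hπ⟩ := h
    exact ⟨π, trivial, hπ.symm⟩

/-- A listed sequence is named by a string whose length is its position, which is below the length
of the encoding. For the arbitrary schedule the `n` values are written in unary, each below `n` and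
followed by a terminator, hence with at most `n` symbols. -/
theorem exists_sequenceOf {I : Instance} {m : ℕ} (h₁ : I.n * I.n ≤ m) (h₂ : I.enc.length ≤ m)
    {π : Equiv.Perm (Fin I.n)} (hπ : I.sched.Permits π) :
    ∃ y : List Bool, y.length ≤ m ∧ sequenceOf I.raw y = (true, permList π) := by
  cases hs : I.sched with
  | list l hl =>
    rw [hs] at hπ
    obtain ⟨p, hp, e⟩ := List.getElem_of_mem hπ
    refine ⟨List.replicate p true, ?_, ?_⟩
    · have h₃ : l.length ≤ I.sched.enc.length := by
        have := length_le_length_flatMap encPerm (by simp [encPerm]) l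
        simp only [hs, Schedule.enc, List.length_append]
        omega
      simp only [Instance.enc, List.length_append] at h₂
      simp
      omega
    · simp only [sequenceOf, Instance.raw, hs, Schedule.raw, cond_false, List.length_replicate,
        List.length_map]
      refine Prod.ext (by simpa using hp) ?_
      simp [List.getD_eq_getElem?_getD, List.getElem?_eq_getElem hp, e]
  | arbitrary =>
    refine ⟨(permList π).flatMap fun m => List.replicate m true ++ [false], ?_, ?_⟩
    · refine le_trans ?_ h₁
      rw [List.length_flatMap]
      have := List.sum_le_card_nsmul
        ((permList π).map fun m => (List.replicate m true ++ [false]).length) I.n (by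
          simp [permList])
      simpa [permList] using this
    · simp only [sequenceOf, Instance.raw, hs, Schedule.raw, cond_true, List.length_ofFn,
        unaryNats_encode]
      exact Prod.ext ((isPermList_iff _).2 ⟨π, rfl⟩) rfl

/-! ### The quantifier game -/

theorem altQuant_of_forall {m : ℕ} {R : List (List Bool) → Prop} {b : Bool} {k : ℕ}
    {pre : List (List Bool)} (h : ∀ ys, R (pre ++ ys)) : AltQuant m R b k pre := by
  induction k generalizing b pre with
  | zero =>
    cases b <;> simpa [AltQuant] using h []
  | succ k ih =>
    cases b with
    | true => exact fun y _ => ih fun ys => by simpa using h (y :: ys)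
    | false => exact ⟨[], by simp, ih fun ys => by simpa using h ([] :: ys)⟩

/-- Serves to extract conditions on the strings already chosen, which hold in `R` whatever follows.
One continuation is enough, and the empty string is always a legal universal choice. -/
theorem exists_of_altQuant {m : ℕ} {R : List (List Bool) → Prop} {b : Bool} {k : ℕ}
    {pre : List (List Bool)} (h : AltQuant m R b k pre) : ∃ ys, R (pre ++ ys) := by
  induction k generalizing b pre with
  | zero =>
    refine ⟨[], ?_⟩
    cases b <;> simpa [AltQuant] using h
  | succ k ih =>
    cases b with
    | true =>
      obtain ⟨ys, hy⟩ := ih (h [] (by simp))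
      exact ⟨[] :: ys, by simpa using hy⟩
    | false =>
      obtain ⟨y, -, h⟩ := h
      obtain ⟨ys, hy⟩ := ih h
      exact ⟨y :: ys, by simpa using hy⟩

/-- Induction on `s`: a universal string naming a sequence and an existential string naming the next
configuration are one time step. Existential strings that violate the length or step test lose, and
universal strings that name no permissible sequence make the test succeed. -/
theorem altQuant_iff_robustlyTakes {I : Instance} {K q m : ℕ} (hI : I.Simple K q)
    (h₁ : I.n * I.n ≤ m) (h₂ : I.enc.length ≤ m) {R : List (List Bool) → Prop} (s : ℕ)
    {pre : List (List Bool)} {c : Config I.n}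
    (hR : ∀ ys, R (pre ++ ys) ↔ checkGame (K * q) s I.raw (List.ofFn c) ys = true) :
    AltQuant m R true (2 * s) pre ↔ RobustlyTakes I.system I.sched (s + 1) c I.d := by
  induction s generalizing pre c with
  | zero =>
    rw [← lastStep_raw hI]
    have := hR []
    rw [List.append_nil] at this
    exact this
  | succ s ih =>
    have hlen : I.raw.2.2.2.2.length = I.n := by simp [Instance.raw]
    have hn : ∀ c' : Config I.n, (List.ofFn c').length ≤ m := fun c' => by
      have := I.n_le_length_enc
      rw [List.length_ofFn]
      omega
    have hgood : ∀ y π, sequenceOf I.raw y = (true, permList π) → ∀ c' : Config I.n,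
        Chain I.system c' (List.ofFn π) c → ∀ ys, R ((pre ++ [y] ++ [List.ofFn c']) ++ ys) ↔
          checkGame (K * q) s I.raw (List.ofFn c') ys = true := by
      intro y π hy c' hc ys
      rw [List.append_assoc, List.append_assoc, hR]
      have hc' := (canStep_raw I (List.ofFn π) c c').2 hc
      simp only [List.singleton_append, checkGame, List.headD_cons, hy, cond_true, List.tail_cons,
        hlen, permList, hc', List.length_ofFn, beq_self_eq_true, Bool.true_and]
    rw [robustlyTakes_succ_iff _ I.k_pos]
    constructor
    · intro h π hπ
      obtain ⟨y, hym, hy⟩ := exists_sequenceOf h₁ h₂ hπ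
      obtain ⟨z, hzm, hz⟩ := h y hym
      -- The tests on `z` do not depend on later strings, so a single continuation shows that `z` is
      -- a configuration reachable under `π`.
      obtain ⟨ys, hys⟩ := exists_of_altQuant hz
      rw [List.append_assoc, List.append_assoc, hR] at hys
      simp only [List.singleton_append, checkGame, List.headD_cons, hy, cond_true, List.tail_cons,
        hlen, Bool.and_eq_true, beq_iff_eq] at hys
      obtain ⟨c', rfl⟩ : ∃ c' : Config I.n, List.ofFn c' = z :=
        ⟨fun i => z[i]'(by rw [hys.1]; exact i.2), by
          refine List.ext_getElem (by simp [hys.1]) fun a b c => by simp⟩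
      have hc := (canStep_raw I (List.ofFn π) c c').1 hys.2.1
      exact ⟨c', hc, (ih (hgood y π hy c' hc)).1 hz⟩
    · intro h y hym
      by_cases hy : (sequenceOf I.raw y).1 = true
      · obtain ⟨π, hπ, e⟩ := exists_of_sequenceOf hy
        obtain ⟨c', hc, h'⟩ := h π hπ
        exact ⟨List.ofFn c', hn c', (ih (hgood y π (Prod.ext hy e) c' hc)).2 h'⟩
      -- Here `y` names no permissible sequence, and any answer is accepted.
      · refine ⟨[], by simp, altQuant_of_forall fun ys => ?_⟩
        rw [List.append_assoc, List.append_assoc, hR]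
        rw [Bool.not_eq_true] at hy
        simp [checkGame, hy]

/-- The restricted problem is decided by the game in which the sequences and the next configurations
of all time steps but the last are chosen alternately. -/
theorem problemInPi (s K q : ℕ) :
    ProblemInPi (2 * s) Instance.enc (Instance.Simple K q) (Instance.Robust (s + 1)) := by
  let R : List Letter × List (List Bool) → Prop :=
    fun w => decideTuple (K * q) s (encTuple w) = true
  -- The square bounds `n * n`, for sequences written in unary; the linear term covers positions in
  -- the list of sequences and configurations.
  let p : Polynomial ℕ := Polynomial.X * Polynomial.X + Polynomial.X
  refine ⟨{x | AltQuant (p.eval x.length) (fun ys => R (x, ys)) true (2 * s) []},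
    ⟨p, R, (PF.decideTuple _ _).polyTimeDecidable, fun x => Iff.rfl⟩, fun I hI => ?_⟩
  have hp : p.eval I.enc.length = I.enc.length * I.enc.length + I.enc.length := by simp [p]
  refine altQuant_iff_robustlyTakes hI ?_ ?_ s fun ys => ?_
  · rw [hp]
    exact (Nat.mul_le_mul I.n_le_length_enc I.n_le_length_enc).trans (Nat.le_add_right _ _)
  · rw [hp]
    exact Nat.le_add_left _ _
  · simp only [R, decideTuple, splitTuple_encTuple, readInstance_enc, List.nil_append]
    rfl

end correct

end BFDS

theorem mainTheorem4 (t : ℕ) (ht : 1 ≤ t) (K q : ℕ) :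
    BFDS.ProblemInPi (2 * (t - 1)) BFDS.Instance.enc
      (BFDS.Instance.Simple K q) (BFDS.Instance.Robust t) := by
  obtain ⟨s, rfl⟩ : ∃ s, t = s + 1 := ⟨t - 1, by omega⟩
  exact BFDS.problemInPi s K q
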